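/- Let $d\ge 1$ and let $\omega:[0,+\infty)\to(0,+\infty)$ be a weight function, that is, $\omega$ is non-decreasing, continuous and unbounded, and $\lim_{t\to+\infty}t^{-k}\omega(t)=\infty$ for all $k\in\mathbb{N}$. Let $\mathcal{A}^\omega(\mathbb{C}^d)$ be the space of all entire functions $f$ on $\mathbb{C}^d$ such that $$\sup_{z\in\mathbb{C}^d}\frac{|f(z)|}{\omega(|z|)}<\infty,$$ and let $\widetilde\omega:[0,+\infty)\to(0,+\infty)$ be the associated weight function, defined by $$\widetilde\omega(|\zeta|)=\sup\{|f(\zeta)| : f:\mathbb{C}\to\mathbb{C}\text{ entire},\ |f(w)|\le\omega(|w|)\text{ for all } w\in\mathbb{C}\},\qquad \zeta\in\mathbb{C}$$ (the right-hand side depends only on $|\zeta|$). Let $\mu$ be a positive Borel measure on $\mathbb{C}^d$ and let $0<q<\infty$. Then $\mu$ is a $q$-Carleson measure for $\mathcal{A}^\omega(\mathbb{C}^d)$, meaning that $\mathcal{A}^\omega(\mathbb{C}^d)\subset L^q(\mathbb{C}^d,\mu)$, if and only if $$\int_{\mathbb{C}^d}\widetilde\omega(|z|)^q\,d\mu(z)<\infty.$$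 -/

import Mathlib

open MeasureTheory Filter
open scoped NNReal ENNReal

namespace GrowthSpaces

/-- The space `ℂ^d` with its Euclidean norm. -/
abbrev Cd (d : ℕ) : Type := EuclideanSpace ℂ (Fin d)

/-- A weight function `ω : [0, ∞) → (0, ∞)`: non-decreasing, continuous, unbounded, and, as is
assumed of all weight functions, growing faster than every power. -/
structure IsWeightFunction (ω : ℝ≥0 → ℝ) : Prop where
  pos : ∀ t, 0 < ω t
  monotone : Monotone ω
  continuous : Continuous ω
  unbounded : ¬ BddAbove (Set.range ω)
  rapid : ∀ k : ℕ, Tendsto (fun t : ℝ≥0 => ω t / (t : ℝ) ^ k) atTop atTop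

/-- The growth space `A^ω(ℂ^d)`: the linear space of entire functions `f` on `ℂ^d` with
`sup_z |f(z)| / ω(|z|) < ∞`. -/
def growthSpace (d : ℕ) (ω : ℝ≥0 → ℝ) (hω : IsWeightFunction ω) :
    Submodule ℂ (Cd d → ℂ) where
  carrier := {f | Differentiable ℂ f ∧ BddAbove (Set.range fun z => ‖f z‖ / ω ‖z‖₊)}
  add_mem' := by
    rintro f g ⟨hf, A, hA⟩ ⟨hg, B, hB⟩
    refine ⟨hf.add hg, A + B, ?_⟩
    rintro _ ⟨z, rfl⟩
    have h1 : ‖f z‖ / ω ‖z‖₊ ≤ A := hA ⟨z, rfl⟩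
    have h2 : ‖g z‖ / ω ‖z‖₊ ≤ B := hB ⟨z, rfl⟩
    calc ‖(f + g) z‖ / ω ‖z‖₊ ≤ (‖f z‖ + ‖g z‖) / ω ‖z‖₊ :=
          div_le_div_of_nonneg_right (norm_add_le _ _) (hω.pos _).le
      _ ≤ A + B := by rw [add_div]; exact add_le_add h1 h2
  zero_mem' := by
    refine ⟨differentiable_const 0, 0, ?_⟩
    rintro _ ⟨z, rfl⟩
    simp
  smul_mem' := by
    rintro c f ⟨hf, A, hA⟩
    refine ⟨hf.const_smul c, ‖c‖ * A, ?_⟩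
    rintro _ ⟨z, rfl⟩
    have h1 : ‖f z‖ / ω ‖z‖₊ ≤ A := hA ⟨z, rfl⟩
    calc ‖(c • f) z‖ / ω ‖z‖₊ = ‖c‖ * (‖f z‖ / ω ‖z‖₊) := by
          rw [Pi.smul_apply, norm_smul, mul_div_assoc]
      _ ≤ ‖c‖ * A := mul_le_mul_of_nonneg_left h1 (norm_nonneg c)

/-- The associated weight of `v` in one complex variable: the supremum of `|f(z)|` over all entire
`f : ℂ → ℂ` with `|f(w)| ≤ v(|w|)` for all `w`. The set is bounded above by `v(|z|)`, and it
contains `0` when `v` is nonnegative. -/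
noncomputable def associatedWeight (v : ℝ≥0 → ℝ) (z : ℂ) : ℝ :=
  sSup {r : ℝ | ∃ f : ℂ → ℂ, Differentiable ℂ f ∧ (∀ w, ‖f w‖ ≤ v ‖w‖₊) ∧ r = ‖f z‖}

/-- The associated weight function on `[0, ∞)`: the associated weight, which is radial,
as a function of `|z|`. -/
noncomputable def associatedWeightFunction (v : ℝ≥0 → ℝ) (t : ℝ≥0) : ℝ :=
  associatedWeight v ((t : ℝ) : ℂ)

/-- The associated weight is radial, so the associated weight function is well defined. -/
theorem associatedWeight_eq (v : ℝ≥0 → ℝ) (z : ℂ) :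
    associatedWeight v z = associatedWeightFunction v ‖z‖₊ := by
  have key : ∀ (u a b : ℂ), ‖u‖ = 1 → u * a = b →
      ∀ r : ℝ, (∃ f : ℂ → ℂ, Differentiable ℂ f ∧ (∀ w, ‖f w‖ ≤ v ‖w‖₊) ∧ r = ‖f b‖) →
        ∃ f : ℂ → ℂ, Differentiable ℂ f ∧ (∀ w, ‖f w‖ ≤ v ‖w‖₊) ∧ r = ‖f a‖ := by
    rintro u a b hu hab r ⟨f, hf, hle, rfl⟩
    have hu' : ‖u‖₊ = 1 := NNReal.eq hu
    refine ⟨fun w => f (u * w), hf.comp (differentiable_id.const_mul u), fun w => ?_, ?_⟩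
    · simpa [nnnorm_mul, hu'] using hle (u * w)
    · simp [hab]
  obtain ⟨u, hu, huz⟩ : ∃ u : ℂ, ‖u‖ = 1 ∧ u * ((‖z‖ : ℝ) : ℂ) = z := by
    refine ⟨Complex.exp (z.arg * Complex.I), Complex.norm_exp_ofReal_mul_I _, ?_⟩
    rw [mul_comm]
    exact Complex.norm_mul_exp_arg_mul_I z
  have hu0 : u ≠ 0 := by
    intro h
    simp [h] at hu
  unfold associatedWeightFunction associatedWeight
  congr 1
  ext r
  exact ⟨key u _ _ hu huz r, key u⁻¹ _ _ (by simp [hu]) (by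
    rw [coe_nnnorm, inv_mul_eq_iff_eq_mul₀ hu0, huz]) r⟩

/-- A positive Borel measure `μ` on `ℂ^d` is `q`-Carleson for a linear space `X` of functions
on `ℂ^d` if `X ⊆ L^q(μ)`. -/
def IsCarleson {d : ℕ} (q : ℝ) (X : Submodule ℂ (Cd d → ℂ)) (μ : Measure (Cd d)) : Prop :=
  ∀ f ∈ X, MemLp f (ENNReal.ofReal q) μ

end GrowthSpaces

/-!
The associated weight dominates every element of the growth space: restrict the function to the
complex lines through the origin. So the integral condition is sufficient. It is necessary because
finitely many elements of the growth space together dominate the associated weight, by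
`exists_finite_majorizing_family`; the rest of the file constructs them.

In one variable, let `a n` be the minimum of `ω r / r ^ n` over `r ≥ 1`, attained at `ρ n`. The
monomials `a n * r ^ n` lie below `ω` and touch it at `ρ n`. An entire function bounded by `ω` is
bounded on `ρ n ≤ |z| ≤ ρ (n + 1)` by twice the sum of the `n`-th and the `(n + 1)`-st monomial:
near the two circles by the maximum principle, and far from them by Cauchy's estimates for its Taylor
coefficients (`norm_le_two_mul_add_of_circles`). Hence the associated weight is at most a
multiple of the supremum of these monomials. The supremum is in turn comparable to that of a sparse
subfamily, whose members decay geometrically away from the largest one (`IsContactFamily.exists_sparse`).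

To pass to `d` variables, `r ^ n` is replaced by homogeneous polynomials of degree `n` which are
bounded by `C * |z| ^ n` and finitely many of which have maximum at least `c * |z| ^ n`, with
constants independent of `n` (`exists_homogeneous_family`). They are sums of normalized monomials
`z ^ α`. On the unit sphere, such a monomial is bounded by the Gaussian
`exp (-∑ (√n |z i| - √(α i)) ^ 2 / 2)`. If the `√(α i)` with `i ≠ i₀` run through an arithmetic
progression of large difference, at most one monomial is large at a given point. The finitely many
residue classes and choices of `i₀` account for all points.

Finally, the sparse subfamily is split into three residue classes of its index, so that in the
class of the largest term this term outweighs the others together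
(`IsContactFamily.le_norm_lacunarySeries`).
-/

namespace GrowthSpaces

/-! ### Series of entire functions of several variables -/

/-- Cauchy's estimate for the Fréchet derivative, obtained on each complex line through `z`. -/
lemma norm_fderiv_le_of_forall_mem_closedBall {E : Type*} [NormedAddCommGroup E]
    [NormedSpace ℂ E] {f : E → ℂ} (hf : Differentiable ℂ f) {z : E} {C : ℝ}
    (hC : ∀ w ∈ Metric.closedBall z 1, ‖f w‖ ≤ C) : ‖fderiv ℂ f z‖ ≤ C := by
  have hC0 : 0 ≤ C := (norm_nonneg _).trans (hC z (by simp))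
  refine ContinuousLinearMap.opNorm_le_of_unit_norm hC0 fun v hv => ?_
  have hline : HasDerivAt (fun t : ℂ => z + t • v) v 0 := by
    simpa using ((hasDerivAt_id (0 : ℂ)).smul_const v).const_add z
  have hd : HasDerivAt (fun t : ℂ => f (z + t • v)) (fderiv ℂ f z v) 0 := by
    have h : HasFDerivAt f (fderiv ℂ f z) (z + (0 : ℂ) • v) := by
      simpa using (hf z).hasFDerivAt
    exact h.comp_hasDerivAt (0 : ℂ) hline
  rw [← hd.deriv]
  have hdiff : Differentiable ℂ fun t : ℂ => f (z + t • v) :=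
    hf.comp (((differentiable_id).smul_const v).const_add z)
  have := Complex.norm_deriv_le_of_forall_mem_sphere_norm_le (c := 0) (R := 1) (C := C)
    (f := fun t : ℂ => f (z + t • v)) one_pos hdiff.diffContOnCl fun t ht => hC _ ?_
  · simpa using this
  · have ht : ‖t‖ = 1 := by simpa using ht
    simp [norm_smul, ht, hv]

/-- A series of entire functions which converges normally on all balls has an entire sum. -/
lemma differentiable_tsum_of_summable_on_balls {E : Type*} [NormedAddCommGroup E]
    [NormedSpace ℂ E] {f : ℕ → E → ℂ} {u : ℝ → ℕ → ℝ} (hf : ∀ n, Differentiable ℂ (f n))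
    (hu : ∀ R, Summable (u R)) (hfu : ∀ R n z, ‖z‖ ≤ R → ‖f n z‖ ≤ u R n) :
    Differentiable ℂ fun z => ∑' n, f n z := by
  intro z
  let _ : NormedSpace ℝ E := NormedSpace.restrictScalars ℝ ℂ E
  refine (hasFDerivAt_tsum_of_isPreconnected (s := Metric.ball z 1)
    (f' := fun n w => fderiv ℂ (f n) w) (hu (‖z‖ + 2))
    Metric.isOpen_ball (convex_ball z 1).isPreconnected
    (fun n w _ => (hf n w).hasFDerivAt) (fun n w hw => ?_) (Metric.mem_ball_self one_pos) ?_
    (Metric.mem_ball_self one_pos)).differentiableAt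
  · refine norm_fderiv_le_of_forall_mem_closedBall (hf n) fun y hy => hfu _ n y ?_
    have h1 : ‖w - z‖ < 1 := by simpa [dist_eq_norm] using hw
    have h2 : ‖y - w‖ ≤ 1 := by simpa [dist_eq_norm] using hy
    calc ‖y‖ = ‖(y - w) + (w - z) + z‖ := by congr 1; abel
      _ ≤ ‖y - w‖ + ‖w - z‖ + ‖z‖ := norm_add₃_le
      _ ≤ ‖z‖ + 2 := by linarith
  · exact .of_norm_bounded (hu ‖z‖) fun n => hfu _ n z le_rfl

/-! ### Entire functions of one variable on an annulus -/

/-- The maximum principle for `f(z) / z ^ N` on the annulus `ρ₁ ≤ |z| ≤ ρ₂`. -/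
lemma norm_le_mul_pow_of_annulus {f : ℂ → ℂ} (hf : Differentiable ℂ f) {ρ₁ ρ₂ c : ℝ} {N : ℕ}
    (h₁ : 0 < ρ₁) (hf₁ : ∀ w, ‖w‖ = ρ₁ → ‖f w‖ ≤ c * ρ₁ ^ N)
    (hf₂ : ∀ w, ‖w‖ = ρ₂ → ‖f w‖ ≤ c * ρ₂ ^ N) {w : ℂ} (hw₁ : ρ₁ ≤ ‖w‖) (hw₂ : ‖w‖ ≤ ρ₂) :
    ‖f w‖ ≤ c * ‖w‖ ^ N := by
  have key : ∀ y : ℂ, 0 < ‖y‖ → (‖f y / y ^ N‖ ≤ c ↔ ‖f y‖ ≤ c * ‖y‖ ^ N) := fun y hy => by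
    rw [norm_div, norm_pow, div_le_iff₀ (pow_pos hy N)]
  rcases hw₁.eq_or_lt with h | hw₁
  · rw [← h]; exact hf₁ w h.symm
  rcases hw₂.eq_or_lt with h | hw₂
  · rw [h]; exact hf₂ w h
  set U : Set ℂ := {y | ρ₁ < ‖y‖ ∧ ‖y‖ < ρ₂}
  have hUo : IsOpen U :=
    (isOpen_lt continuous_const continuous_norm).inter (isOpen_lt continuous_norm continuous_const)
  have hcl : closure U ⊆ {y | ρ₁ ≤ ‖y‖ ∧ ‖y‖ ≤ ρ₂} := closure_minimal
    (fun y hy => ⟨hy.1.le, hy.2.le⟩)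
    ((isClosed_le continuous_const continuous_norm).inter
      (isClosed_le continuous_norm continuous_const))
  have hUb : Bornology.IsBounded U := by
    refine (Metric.isBounded_closedBall (x := (0 : ℂ)) (r := ρ₂)).subset fun y hy => ?_
    simpa using hy.2.le
  have hd : DifferentiableOn ℂ (fun y => f y / y ^ N) (closure U) := fun y hy => by
    have : y ≠ 0 := norm_pos_iff.1 (h₁.trans_le (hcl hy).1)
    exact ((hf y).div (differentiableAt_id.pow N) (pow_ne_zero N this)).differentiableWithinAt
  refine (key w (h₁.trans hw₁)).1 (Complex.norm_le_of_forall_mem_frontier_norm_le hUb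
    hd.diffContOnCl (fun y hy => ?_) (subset_closure (show w ∈ U from ⟨hw₁, hw₂⟩)))
  rw [hUo.frontier_eq] at hy
  obtain ⟨hy₁, hy₂⟩ := hcl hy.1
  refine (key y (h₁.trans_le hy₁)).2 ?_
  rcases hy₁.eq_or_lt with h | h
  · rw [← h]; exact hf₁ y h.symm
  · have : ‖y‖ = ρ₂ := le_antisymm hy₂ (not_lt.1 fun h' => hy.2 ⟨h, h'⟩)
    rw [this]; exact hf₂ y this

lemma sum_half_pow_sub_le (s : Finset ℕ) (k : ℕ) (hs : ∀ m ∈ s, k ≤ m) :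
    ∑ m ∈ s, (1 / 2 : ℝ) ^ (m - k) ≤ 2 := by
  calc ∑ m ∈ s, (1 / 2 : ℝ) ^ (m - k) = ∑ j ∈ s.image (· - k), (1 / 2 : ℝ) ^ j := by
        rw [Finset.sum_image]
        intro a ha b hb h
        have := hs a ha
        have := hs b hb
        simp only at h
        omega
    _ ≤ ∑' j : ℕ, (1 / 2 : ℝ) ^ j :=
        summable_geometric_two.sum_le_tsum _ fun _ _ => by positivity
    _ = 2 := tsum_geometric_two

lemma sum_half_pow_sub_le' (s : Finset ℕ) (k : ℕ) (hs : ∀ m ∈ s, m ≤ k) :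
    ∑ m ∈ s, (1 / 2 : ℝ) ^ (k - m) ≤ 2 := by
  calc ∑ m ∈ s, (1 / 2 : ℝ) ^ (k - m) = ∑ j ∈ s.image (k - ·), (1 / 2 : ℝ) ^ j := by
        rw [Finset.sum_image]
        intro a ha b hb h
        have := hs a ha
        have := hs b hb
        simp only at h
        omega
    _ ≤ ∑' j : ℕ, (1 / 2 : ℝ) ^ j :=
        summable_geometric_two.sum_le_tsum _ fun _ _ => by positivity
    _ = 2 := tsum_geometric_two

/-- The truncated differences in the exponent add up to `|m - k|`. -/
lemma sum_half_pow_dist_le (s : Finset ℕ) (k : ℕ) :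
    ∑ m ∈ s, (1 / 2 : ℝ) ^ ((m - k) + (k - m)) ≤ 4 := by
  rw [← Finset.sum_filter_add_sum_filter_not s (k ≤ ·)]
  have h₁ := sum_half_pow_sub_le (s.filter (k ≤ ·)) k (by simp)
  have h₂ := sum_half_pow_sub_le' (s.filter (¬ k ≤ ·)) k (by simp; omega)
  have e₁ : ∑ m ∈ s.filter (k ≤ ·), (1 / 2 : ℝ) ^ ((m - k) + (k - m)) =
      ∑ m ∈ s.filter (k ≤ ·), (1 / 2 : ℝ) ^ (m - k) :=
    Finset.sum_congr rfl fun m hm => by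
      have := (Finset.mem_filter.1 hm).2
      congr 1; omega
  have e₂ : ∑ m ∈ s.filter (¬ k ≤ ·), (1 / 2 : ℝ) ^ ((m - k) + (k - m)) =
      ∑ m ∈ s.filter (¬ k ≤ ·), (1 / 2 : ℝ) ^ (k - m) :=
    Finset.sum_congr rfl fun m hm => by
      have := (Finset.mem_filter.1 hm).2
      congr 1; omega
  linarith

/-- If an entire function is bounded by `a r ^ N` on the circle of radius `ρ₁` and by
`b r ^ (N + 1)` on the circle of radius `ρ₂`, where the first bound dominates at `ρ₁` and the second
at `ρ₂`, then in between it is bounded by a multiple of their sum. -/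
lemma norm_le_two_mul_add_of_circles {f : ℂ → ℂ} (hf : Differentiable ℂ f) {ρ₁ ρ₂ a b : ℝ}
    {N : ℕ} (ha : 0 < a) (hb : 0 < b) (h₁ : 0 < ρ₁) (hab₁ : b * ρ₁ ≤ a) (hab₂ : a ≤ b * ρ₂)
    (hf₁ : ∀ w, ‖w‖ = ρ₁ → ‖f w‖ ≤ a * ρ₁ ^ N)
    (hf₂ : ∀ w, ‖w‖ = ρ₂ → ‖f w‖ ≤ b * ρ₂ ^ (N + 1)) {w : ℂ}
    (hw₁ : ρ₁ ≤ ‖w‖) (hw₂ : ‖w‖ ≤ ρ₂) :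
    ‖f w‖ ≤ 2 * (a * ‖w‖ ^ N + b * ‖w‖ ^ (N + 1)) := by
  set r := ‖w‖ with hr
  have hr0 : 0 < r := h₁.trans_le hw₁
  have h₂ : 0 < ρ₂ := hr0.trans_le hw₂
  have hA : 0 < a * r ^ N := by positivity
  have hB : 0 < b * r ^ (N + 1) := by positivity
  rcases le_total r (2 * ρ₁) with hc | hc
  · have := norm_le_mul_pow_of_annulus (ρ₁ := ρ₁) (ρ₂ := ρ₂) (c := a / ρ₁) (N := N + 1) hf h₁
      (fun y hy => (hf₁ y hy).trans_eq (by field_simp; ring))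
      (fun y hy => (hf₂ y hy).trans (by gcongr; rwa [le_div_iff₀ h₁])) hw₁ hw₂
    have h3 : a / ρ₁ * r ^ (N + 1) = a * r ^ N * (r / ρ₁) := by field_simp; ring
    have h4 : r / ρ₁ ≤ 2 := by rwa [div_le_iff₀ h₁]
    rw [← hr, h3] at this
    nlinarith [mul_le_mul_of_nonneg_left h4 hA.le]
  rcases le_total ρ₂ (2 * r) with hc' | hc'
  · have := norm_le_mul_pow_of_annulus (ρ₁ := ρ₁) (ρ₂ := ρ₂) (c := b * ρ₂) (N := N) hf h₁
      (fun y hy => (hf₁ y hy).trans (by gcongr))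
      (fun y hy => (hf₂ y hy).trans_eq (by ring)) hw₁ hw₂
    have h3 : b * ρ₂ * r ^ N ≤ b * (2 * r) * r ^ N := by gcongr
    rw [← hr] at this
    have h4 : b * (2 * r) * r ^ N = 2 * (b * r ^ (N + 1)) := by ring
    linarith
  -- Far from both circles, Cauchy's estimates on them bound the Taylor series of `f`.
  have hs := Complex.hasSum_taylorSeries_of_entire hf 0 w
  have hcoef : ∀ {ρ M : ℝ}, 0 < ρ → (∀ y, ‖y‖ = ρ → ‖f y‖ ≤ M) → ∀ m : ℕ,
      ‖(m.factorial : ℂ)⁻¹ • (w - 0) ^ m • iteratedDeriv m f 0‖ ≤ M * (r / ρ) ^ m := by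
    intro ρ M hρ hM m
    have := Complex.norm_iteratedDeriv_le_of_forall_mem_sphere_norm_le (c := 0) (C := M) m hρ
      hf.diffContOnCl fun y hy => hM y (by simpa using hy)
    have hm : (0 : ℝ) < m.factorial := by positivity
    rw [norm_smul, norm_smul, norm_inv, norm_pow, sub_zero, Complex.norm_natCast, ← hr]
    calc (m.factorial : ℝ)⁻¹ * (r ^ m * ‖iteratedDeriv m f 0‖)
        ≤ (m.factorial : ℝ)⁻¹ * (r ^ m * (m.factorial * M / ρ ^ m)) := by gcongr
      _ = M * (r / ρ) ^ m := by rw [div_pow]; field_simp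
  refine le_of_tendsto hs.norm (Eventually.of_forall fun s => ?_)
  rw [← Finset.sum_filter_add_sum_filter_not s (· ≤ N)]
  refine (norm_add_le _ _).trans ?_
  rw [mul_add]
  refine add_le_add ?_ ?_
  · calc _ ≤ ∑ m ∈ s.filter (· ≤ N), a * r ^ N * (1 / 2 : ℝ) ^ (N - m) := by
          refine norm_sum_le_of_le _ fun m hm => (hcoef h₁ hf₁ m).trans ?_
          obtain ⟨j, rfl⟩ := Nat.exists_eq_add_of_le (Finset.mem_filter.1 hm).2
          have h3 : a * ρ₁ ^ (m + j) * (r / ρ₁) ^ m = a * r ^ (m + j) * (ρ₁ / r) ^ j := by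
            rw [div_pow, div_pow, pow_add, pow_add]; field_simp
          rw [h3, Nat.add_sub_cancel_left]
          have h4 : ρ₁ / r ≤ 1 / 2 := by rw [div_le_iff₀ hr0]; linarith
          exact mul_le_mul_of_nonneg_left (pow_le_pow_left₀ (by positivity) h4 j) hA.le
      _ ≤ a * r ^ N * 2 := by
          rw [← Finset.mul_sum]
          gcongr
          exact sum_half_pow_sub_le' _ _ fun m hm => (Finset.mem_filter.1 hm).2
      _ = 2 * (a * r ^ N) := by ring
  · calc _ ≤ ∑ m ∈ s.filter (¬ · ≤ N), b * r ^ (N + 1) * (1 / 2 : ℝ) ^ (m - (N + 1)) := by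
          refine norm_sum_le_of_le _ fun m hm => (hcoef h₂ hf₂ m).trans ?_
          obtain ⟨j, rfl⟩ := Nat.exists_eq_add_of_lt (not_le.1 (Finset.mem_filter.1 hm).2)
          have h3 : b * ρ₂ ^ (N + 1) * (r / ρ₂) ^ (N + j + 1) =
              b * r ^ (N + 1) * (r / ρ₂) ^ j := by
            rw [div_pow, div_pow, show N + j + 1 = (N + 1) + j by ring, pow_add r,
              pow_add ρ₂ (N + 1)]
            field_simp
          rw [h3, show N + j + 1 - (N + 1) = j by omega]
          have h4 : r / ρ₂ ≤ 1 / 2 := by rw [div_le_iff₀ h₂]; linarith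
          exact mul_le_mul_of_nonneg_left (pow_le_pow_left₀ (by positivity) h4 j) hB.le
      _ ≤ b * r ^ (N + 1) * 2 := by
          rw [← Finset.mul_sum]
          gcongr
          refine sum_half_pow_sub_le _ _ fun m hm => ?_
          have := (Finset.mem_filter.1 hm).2
          omega
      _ = 2 * (b * r ^ (N + 1)) := by ring

/-! ### Majorizing the associated weight by monomials -/

/-- Monomials `a n * r ^ n` together with points of contact `ρ n`: at `ρ n` the `n`-th monomial is
the largest of all. -/
structure IsContactFamily (a ρ : ℕ → ℝ) : Prop where
  coeff_pos : ∀ n, 0 < a n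
  one_le : ∀ n, 1 ≤ ρ n
  contact : ∀ n m, a m * ρ n ^ m ≤ a n * ρ n ^ n

/-- The inequality `a n r ^ n ≤ c a m r ^ m`, where `n ≤ m`, persists when `r` increases. -/
lemma mul_pow_le_mul_pow_of_le_right {a b c r₀ r : ℝ} {n m : ℕ} (hr₀ : 0 < r₀) (hr : r₀ ≤ r)
    (hnm : n ≤ m) (hb : 0 ≤ c * b) (h : a * r₀ ^ n ≤ c * (b * r₀ ^ m)) :
    a * r ^ n ≤ c * (b * r ^ m) := by
  obtain ⟨j, rfl⟩ := Nat.exists_eq_add_of_le hnm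
  have h1 : a ≤ c * b * r₀ ^ j := by
    refine le_of_mul_le_mul_right (a := r₀ ^ n) ?_ (by positivity)
    calc a * r₀ ^ n ≤ _ := h
      _ = _ := by rw [pow_add]; ring
  calc a * r ^ n ≤ c * b * r₀ ^ j * r ^ n := by
        have : 0 ≤ r := hr₀.le.trans hr
        gcongr
    _ ≤ c * b * r ^ j * r ^ n := by
        have : 0 ≤ r := hr₀.le.trans hr
        gcongr
    _ = _ := by rw [pow_add]; ring

/-- The inequality `b r ^ m ≤ c a r ^ n`, where `n ≤ m`, persists when `r` decreases. -/
lemma mul_pow_le_mul_pow_of_le_left {a b c r₀ r : ℝ} {n m : ℕ} (hr : 0 ≤ r) (hr₀ : r ≤ r₀)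
    (hnm : n ≤ m) (hb : 0 ≤ b) (h : b * r₀ ^ m ≤ c * (a * r₀ ^ n)) :
    b * r ^ m ≤ c * (a * r ^ n) := by
  obtain ⟨j, rfl⟩ := Nat.exists_eq_add_of_le hnm
  rcases (hr.trans hr₀).eq_or_lt with h0 | h0
  · obtain rfl : r = r₀ := le_antisymm hr₀ (h0 ▸ hr)
    exact h
  have h1 : b * r₀ ^ j ≤ c * a := by
    refine le_of_mul_le_mul_right (a := r₀ ^ n) ?_ (by positivity)
    calc b * r₀ ^ j * r₀ ^ n = b * r₀ ^ (n + j) := by rw [pow_add]; ring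
      _ ≤ _ := h
      _ = _ := by ring
  calc b * r ^ (n + j) = b * r ^ j * r ^ n := by rw [pow_add]; ring
    _ ≤ b * r₀ ^ j * r ^ n := by gcongr
    _ ≤ c * a * r ^ n := by gcongr
    _ = _ := by ring

namespace IsContactFamily

variable {a ρ : ℕ → ℝ} (h : IsContactFamily a ρ)
include h

lemma pos (n : ℕ) : 0 < ρ n := one_pos.trans_le (h.one_le n)

lemma le_of_contact_le {n m : ℕ} (hnm : n ≤ m) {r : ℝ} (hr : ρ m ≤ r) :
    a n * r ^ n ≤ a m * r ^ m := by
  simpa using mul_pow_le_mul_pow_of_le_right (c := 1) (h.pos m) hr hnm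
    (by simpa using (h.coeff_pos m).le) (by simpa using h.contact m n)

lemma le_of_le_contact {n m : ℕ} (hnm : n ≤ m) {r : ℝ} (hr₀ : 0 ≤ r) (hr : r ≤ ρ n) :
    a m * r ^ m ≤ a n * r ^ n := by
  simpa using mul_pow_le_mul_pow_of_le_left (c := 1) hr₀ hr hnm (h.coeff_pos m).le
    (by simpa using h.contact n m)

lemma monotone : Monotone ρ := by
  intro n m hnm
  rcases hnm.eq_or_lt with rfl | hlt
  · rfl
  obtain ⟨j, rfl⟩ := Nat.exists_eq_add_of_lt hlt
  have e₁ := h.contact n (n + j + 1)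
  have e₂ := h.contact (n + j + 1) n
  have hn := h.pos n
  have hm := h.pos (n + j + 1)
  rw [add_assoc, pow_add] at e₁ e₂
  have e₃ : a (n + (j + 1)) * ρ n ^ (j + 1) ≤ a n :=
    le_of_mul_le_mul_right (a := ρ n ^ n) (by linarith) (by positivity)
  have e₄ : a n ≤ a (n + (j + 1)) * ρ (n + (j + 1)) ^ (j + 1) :=
    le_of_mul_le_mul_right (a := ρ (n + (j + 1)) ^ n) (by linarith) (pow_pos hm n)
  have e₅ := le_of_mul_le_mul_left (e₃.trans e₄) (h.coeff_pos _)
  exact le_of_pow_le_pow_left₀ (Nat.succ_ne_zero j) hm.le e₅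

end IsContactFamily

/-- The monomials touching a weight from below on `[1, ∞)`: `a n` is the minimum of
`v r / r ^ n` and `ρ n` is a point where it is attained. -/
lemma exists_contactFamily {ω : ℝ≥0 → ℝ} (hω : IsWeightFunction ω) :
    ∃ a ρ : ℕ → ℝ, IsContactFamily a ρ ∧ Tendsto ρ atTop atTop ∧
      (∀ n r, 1 ≤ r → a n * r ^ n ≤ ω r.toNNReal) ∧
      ∀ n, a n * ρ n ^ n = ω (ρ n).toNNReal := by
  have hcont : Continuous fun r : ℝ => ω r.toNNReal := hω.continuous.comp continuous_real_toNNReal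
  have hmin : ∀ n : ℕ, ∃ p : ℝ, 1 ≤ p ∧
      ∀ r : ℝ, 1 ≤ r → ω p.toNNReal / p ^ n ≤ ω r.toNNReal / r ^ n := by
    intro n
    have h1 : ∀ᶠ r : ℝ in atTop, ω 1 ≤ ω r.toNNReal / r ^ n := by
      filter_upwards [((hω.rapid n).comp tendsto_real_toNNReal_atTop).eventually_ge_atTop (ω 1),
        eventually_ge_atTop (0 : ℝ)] with r hr hr0
      simpa [Real.coe_toNNReal r hr0] using hr
    obtain ⟨T, hT⟩ := eventually_atTop.1 h1
    have hc : ContinuousOn (fun r : ℝ => ω r.toNNReal / r ^ n) (Set.Icc 1 (max 1 T)) :=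
      hcont.continuousOn.div (continuous_pow n).continuousOn fun r hr =>
        pow_ne_zero n (one_pos.trans_le hr.1).ne'
    obtain ⟨p, hp, hpm⟩ := isCompact_Icc.exists_isMinOn ⟨1, le_rfl, le_max_left 1 T⟩ hc
    refine ⟨p, hp.1, fun r hr => ?_⟩
    rcases le_total r (max 1 T) with h | h
    · exact hpm ⟨hr, h⟩
    · calc _ ≤ ω (1 : ℝ).toNNReal / (1 : ℝ) ^ n := hpm ⟨le_rfl, le_max_left 1 T⟩
        _ = ω 1 := by simp
        _ ≤ _ := hT r ((le_max_right 1 T).trans h)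
  choose ρ hρ1 hρ using hmin
  have hρ0 : ∀ n, 0 < ρ n := fun n => one_pos.trans_le (hρ1 n)
  have hle : ∀ n r, 1 ≤ r → ω (ρ n).toNNReal / ρ n ^ n * r ^ n ≤ ω r.toNNReal := fun n r hr => by
    have := hρ n r hr
    rwa [le_div_iff₀ (pow_pos (one_pos.trans_le hr) n)] at this
  have heq : ∀ n, ω (ρ n).toNNReal / ρ n ^ n * ρ n ^ n = ω (ρ n).toNNReal := fun n =>
    div_mul_cancel₀ _ (pow_pos (hρ0 n) n).ne'
  have hfam : IsContactFamily (fun n => ω (ρ n).toNNReal / ρ n ^ n) ρ :=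
    ⟨fun n => div_pos (hω.pos _) (pow_pos (hρ0 n) n), hρ1,
      fun n m => (hle m _ (hρ1 n)).trans_eq (heq n).symm⟩
  refine ⟨_, ρ, hfam, tendsto_atTop_atTop_of_monotone hfam.monotone fun T => ?_, hle, heq⟩
  -- If `ρ n ≤ T` for all `n`, comparing the values at `ρ n` and `2 T` bounds `2 ^ n`.
  by_contra! hT
  have hT1 : 1 < T := (hρ1 0).trans_lt (hT 0)
  obtain ⟨n, hn⟩ := pow_unbounded_of_one_lt (ω (2 * T).toNNReal / ω 0) one_lt_two
  have h1 := hle n (2 * T) (by linarith)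
  have h2 : ω 0 / T ^ n ≤ ω (ρ n).toNNReal / ρ n ^ n :=
    div_le_div₀ (hω.pos _).le (hω.monotone zero_le) (pow_pos (hρ0 n) n)
      (pow_le_pow_left₀ (hρ0 n).le (hT n).le n)
  rw [div_lt_iff₀ (hω.pos 0)] at hn
  have hTn : 0 < T ^ n := by positivity
  have h3 : ω 0 / T ^ n * (2 * T) ^ n = 2 ^ n * ω 0 := by rw [mul_pow]; field_simp
  have h4 : ω 0 / T ^ n * (2 * T) ^ n ≤ ω (ρ n).toNNReal / ρ n ^ n * (2 * T) ^ n := by gcongr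
  linarith

/-- Between consecutive points of contact, the associated weight is dominated by the two
corresponding monomials. -/
lemma associatedWeightFunction_le {ω : ℝ≥0 → ℝ} (hω : IsWeightFunction ω) {a ρ : ℕ → ℝ}
    (h : IsContactFamily a ρ) (heq : ∀ n, a n * ρ n ^ n = ω (ρ n).toNNReal) {N : ℕ} {t : ℝ≥0}
    (h₁ : ρ N ≤ t) (h₂ : t ≤ ρ (N + 1)) :
    associatedWeightFunction ω t ≤ 2 * (a N * (t : ℝ) ^ N + a (N + 1) * (t : ℝ) ^ (N + 1)) := by
  have ht : ‖((t : ℝ) : ℂ)‖ = t := by simp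
  refine csSup_le ⟨_, fun _ => 0, differentiable_const 0, fun w => by simpa using (hω.pos _).le,
    rfl⟩ ?_
  rintro _ ⟨f, hf, hfω, rfl⟩
  have hcirc : ∀ n, ∀ w : ℂ, ‖w‖ = ρ n → ‖f w‖ ≤ a n * ρ n ^ n := fun n w hw => by
    rw [heq, ← hw, norm_toNNReal]
    exact hfω w
  have e₁ := h.contact N (N + 1)
  have e₂ := h.contact (N + 1) N
  have p₁ := h.pos N
  have p₂ := h.pos (N + 1)
  rw [pow_succ] at e₁ e₂
  have := norm_le_two_mul_add_of_circles hf (h.coeff_pos N) (h.coeff_pos (N + 1)) p₁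
    (le_of_mul_le_mul_right (a := ρ N ^ N) (by linarith) (by positivity))
    (le_of_mul_le_mul_right (a := ρ (N + 1) ^ N) (by linarith) (by positivity))
    (hcirc N) (hcirc (N + 1)) (w := ((t : ℝ) : ℂ)) (by rwa [ht]) (by rwa [ht])
  rwa [ht] at this

/-! ### A sparse subfamily of monomials -/

lemma exists_le_lt_succ_of_tendsto_atTop {x : ℕ → ℝ} (hx : Tendsto x atTop atTop) {r : ℝ}
    (h₀ : x 0 ≤ r) : ∃ l, x l ≤ r ∧ r < x (l + 1) := by
  classical
  have hex : ∃ l, r < x (l + 1) :=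
    (((tendsto_add_atTop_iff_nat 1).2 hx).eventually_gt_atTop r).exists
  refine ⟨Nat.find hex, ?_, Nat.find_spec hex⟩
  rcases hl : Nat.find hex with _ | l
  · exact h₀
  · exact not_lt.1 (Nat.find_min hex (m := l) (by omega))

namespace IsContactFamily

variable {a ρ : ℕ → ℝ} (h : IsContactFamily a ρ)
include h

lemma summable_mul_pow (hρ : Tendsto ρ atTop atTop) {R : ℝ} (hR : 0 ≤ R) :
    Summable fun n => a n * R ^ n := by
  obtain ⟨i, hi⟩ := (hρ.eventually_ge_atTop (2 * R)).exists
  refine Summable.of_nonneg_of_le (fun n => mul_nonneg (h.coeff_pos n).le (pow_nonneg hR n))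
    (fun n => ?_) (summable_geometric_two.mul_left (a i * ρ i ^ i))
  have ha := (h.coeff_pos n).le
  calc a n * R ^ n = a n * (2 * R) ^ n * (1 / 2) ^ n := by
        rw [mul_assoc, ← mul_pow]; congr 2; ring
    _ ≤ a n * ρ i ^ n * (1 / 2) ^ n := by gcongr
    _ ≤ a i * ρ i ^ i * (1 / 2) ^ n := 
        mul_le_mul_of_nonneg_right (h.contact i n) (by positivity)

/-- There is a last index `m > n` such that the `n`-th and the `m`-th monomial majorize, up to the
factor `K`, all others between their points of contact. -/
lemma exists_greatest_admissible (hρ : Tendsto ρ atTop atTop) {K : ℝ} (hK : 1 ≤ K) (n : ℕ) :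
    ∃ m, n < m ∧
      (∀ r, ρ n ≤ r → r ≤ ρ m → ∀ j, a j * r ^ j ≤ K * max (a n * r ^ n) (a m * r ^ m)) ∧
      ∀ m', m < m' → ∃ r, ρ n ≤ r ∧ r ≤ ρ m' ∧
        ∃ j, K * max (a n * r ^ n) (a m' * r ^ m') < a j * r ^ j := by
  classical
  set A : ℕ → Prop := fun m => n < m ∧ ∀ r, ρ n ≤ r → r ≤ ρ m → ∀ j,
    a j * r ^ j ≤ K * max (a n * r ^ n) (a m * r ^ m)
  have hsucc : A (n + 1) := by
    refine ⟨n.lt_succ_self, fun r h₁ h₂ j => ?_⟩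
    have hr : 0 < r := (h.pos n).trans_le h₁
    have hpos : 0 ≤ max (a n * r ^ n) (a (n + 1) * r ^ (n + 1)) :=
      le_max_of_le_left (mul_nonneg (h.coeff_pos n).le (by positivity))
    refine le_trans ?_ (le_mul_of_one_le_left hpos hK)
    rcases Nat.lt_or_ge n j with hj | hj
    · exact le_max_of_le_right (h.le_of_le_contact hj hr.le h₂)
    · exact le_max_of_le_left (h.le_of_contact_le hj h₁)
  -- At a distant point of contact the `j`-th monomial beats the `n`-th and all late ones.
  have hbdd : ∃ B, ∀ m, B < m → ¬ A m := by
    obtain ⟨j, hj, hnj⟩ := ((hρ.eventually_gt_atTop (K * a n / a (n + 1))).and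
      (eventually_gt_atTop n)).exists
    have hρj := h.pos j
    have h₁ : K * (a n * ρ j ^ n) < a j * ρ j ^ j := by
      rw [div_lt_iff₀ (h.coeff_pos _)] at hj
      calc K * (a n * ρ j ^ n) = K * a n * ρ j ^ n := by ring
        _ < ρ j * a (n + 1) * ρ j ^ n := by gcongr
        _ = a (n + 1) * ρ j ^ (n + 1) := by ring
        _ ≤ _ := h.contact j (n + 1)
    have h₂ : ∀ᶠ m in atTop, K * (a m * ρ j ^ m) < a j * ρ j ^ j := by
      have := ((h.summable_mul_pow hρ hρj.le).tendsto_atTop_zero).const_mul K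
      rw [mul_zero] at this
      exact this.eventually_lt_const (mul_pos (h.coeff_pos j) (by positivity))
    obtain ⟨B, hB⟩ := eventually_atTop.1 h₂
    refine ⟨max B j, fun m hm hAm => ?_⟩
    have h₃ := hAm.2 (ρ j) (h.monotone hnj.le)
      (h.monotone ((le_max_right B j).trans hm.le)) j
    rw [mul_max_of_nonneg _ _ (zero_le_one.trans hK)] at h₃
    exact (max_lt h₁ (hB m ((le_max_left B j).trans hm.le))).not_ge h₃
  obtain ⟨B, hB⟩ := hbdd
  have hn1B : n + 1 ≤ B := not_lt.1 fun hlt => hB _ hlt hsucc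
  have hspec : A (Nat.findGreatest A B) := Nat.findGreatest_spec hn1B hsucc
  refine ⟨Nat.findGreatest A B, hspec.1, hspec.2, fun m' hm' => ?_⟩
  have hnot : ¬ A m' := by
    rcases Nat.lt_or_ge B m' with hlt | hge
    · exact hB m' hlt
    · exact Nat.findGreatest_is_greatest hm' hge
  by_contra! hcon
  exact hnot ⟨hspec.1.trans hm', hcon⟩

/-- A subfamily of the monomials which is rich enough to majorize the whole family up to the factor
`K`, and sparse enough that, away from the largest of its monomials, it decays by a factor `K` every
three steps. It arises by always passing to the last monomial which, together with the current one,
majorizes everything between their points of contact. -/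
lemma exists_sparse (hρ : Tendsto ρ atTop atTop) {K : ℝ} (hK : 1 ≤ K) :
    ∃ n : ℕ → ℕ, StrictMono n ∧ ∀ r, ρ 0 ≤ r → ∃ k,
      (∀ j, a j * r ^ j ≤ K * (a (n k) * r ^ n k)) ∧
      (∀ i p, k + 3 * p ≤ i → K ^ p * (a (n i) * r ^ n i) ≤ a (n k) * r ^ n k) ∧
      ∀ i p, i + 3 * p ≤ k → K ^ p * (a (n i) * r ^ n i) ≤ a (n k) * r ^ n k := by
  have hK0 : 0 < K := one_pos.trans_le hK
  choose nxt hlt hcov hgap using h.exists_greatest_admissible hρ hK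
  set n : ℕ → ℕ := fun k => nxt^[k] 0
  have hsucc : ∀ k, n (k + 1) = nxt (n k) := fun k => Function.iterate_succ_apply' nxt k 0
  have hmono : StrictMono n := strictMono_nat_of_lt_succ fun k => by rw [hsucc]; exact hlt _
  have hterm : ∀ i, ∀ r : ℝ, 0 ≤ r → 0 ≤ a i * r ^ i := fun i r hr =>
    mul_nonneg (h.coeff_pos i).le (pow_nonneg hr i)
  -- The failure of the pair `n l`, `n (l + 2)` is witnessed by a monomial strictly between them.
  have hwit : ∀ l, ∃ j r, n l ≤ j ∧ j ≤ n (l + 2) ∧ ρ (n l) ≤ r ∧ r ≤ ρ (n (l + 2)) ∧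
      K * (a (n l) * r ^ n l) ≤ a j * r ^ j ∧
      K * (a (n (l + 2)) * r ^ n (l + 2)) ≤ a j * r ^ j := by
    intro l
    obtain ⟨r, h₁, h₂, j, hj⟩ := hgap (n l) (n (l + 2)) (by rw [← hsucc]; exact hmono (by omega))
    have hr : 0 < r := (h.pos _).trans_le h₁
    rw [mul_max_of_nonneg _ _ hK0.le, max_lt_iff] at hj
    refine ⟨j, r, ?_, ?_, h₁, h₂, hj.1.le, hj.2.le⟩
    · by_contra! hc
      have := h.le_of_contact_le hc.le h₁
      nlinarith [hterm (n l) r hr.le]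
    · by_contra! hc
      have := h.le_of_le_contact hc.le hr.le h₂
      nlinarith [hterm (n (l + 2)) r hr.le]
  have hup : ∀ l r, ρ (n (l + 2)) ≤ r →
      K * (a (n l) * r ^ n l) ≤ a (n (l + 2)) * r ^ n (l + 2) := by
    intro l r hr
    obtain ⟨j, r', hj₁, hj₂, h₁, h₂, h₃, -⟩ := hwit l
    refine le_trans ?_ (h.le_of_contact_le hj₂ hr)
    have := mul_pow_le_mul_pow_of_le_right (a := K * a (n l)) (b := a j) (c := 1)
      ((h.pos _).trans_le h₁) (h₂.trans hr) hj₁ (by simpa using (h.coeff_pos j).le)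
      (by rw [one_mul, mul_assoc]; exact h₃)
    rwa [one_mul, mul_assoc] at this
  have hdown : ∀ l r, 0 ≤ r → r ≤ ρ (n l) →
      K * (a (n (l + 2)) * r ^ n (l + 2)) ≤ a (n l) * r ^ n l := by
    intro l r hr₀ hr
    obtain ⟨j, r', hj₁, hj₂, h₁, h₂, -, h₃⟩ := hwit l
    refine le_trans ?_ (h.le_of_le_contact hj₁ hr₀ hr)
    have := mul_pow_le_mul_pow_of_le_left (a := a j) (b := K * a (n (l + 2))) (c := 1) hr₀
      (hr.trans h₁) hj₂ (mul_nonneg hK0.le (h.coeff_pos _).le)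
      (by rw [one_mul, mul_assoc]; exact h₃)
    rwa [one_mul, mul_assoc] at this
  have hup' : ∀ p i l r, ρ (n l) ≤ r → i + 2 * p ≤ l →
      K ^ p * (a (n i) * r ^ n i) ≤ a (n l) * r ^ n l := by
    intro p
    induction p with
    | zero =>
      intro i l r hr hi
      simpa using h.le_of_contact_le (hmono.monotone (by omega)) hr
    | succ p ih =>
      intro i l r hr hi
      refine le_trans ?_ (ih (i + 2) l r hr (by omega))
      rw [pow_succ, mul_assoc]
      exact mul_le_mul_of_nonneg_left
        (hup i r ((h.monotone (hmono.monotone (by omega))).trans hr)) (pow_nonneg hK0.le p)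
  have hdown' : ∀ p i l r, 0 ≤ r → r ≤ ρ (n l) → l + 2 * p ≤ i →
      K ^ p * (a (n i) * r ^ n i) ≤ a (n l) * r ^ n l := by
    intro p
    induction p with
    | zero =>
      intro i l r hr₀ hr hi
      simpa using h.le_of_le_contact (hmono.monotone (by omega)) hr₀ hr
    | succ p ih =>
      intro i l r hr₀ hr hi
      obtain ⟨i, rfl⟩ := Nat.exists_eq_add_of_le (show 2 ≤ i by omega)
      refine le_trans ?_ (ih i l r hr₀ hr (by omega))
      rw [pow_succ, mul_assoc, add_comm 2 i]
      exact mul_le_mul_of_nonneg_left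
        (hdown i r hr₀ (hr.trans (h.monotone (hmono.monotone (by omega))))) (pow_nonneg hK0.le p)
  refine ⟨n, hmono, fun r hr => ?_⟩
  obtain ⟨l, h₁, h₂⟩ := exists_le_lt_succ_of_tendsto_atTop (hρ.comp hmono.tendsto_atTop) hr
  simp only [Function.comp_apply] at h₁ h₂
  have hr₀ : 0 ≤ r := (h.pos _).le.trans h₁
  have hcov' := hcov (n l) r h₁ (by rw [← hsucc]; exact h₂.le)
  rw [← hsucc] at hcov'
  rcases le_total (a (n l) * r ^ n l) (a (n (l + 1)) * r ^ n (l + 1)) with hle | hle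
  · refine ⟨l + 1, fun j => by simpa [max_eq_right hle] using hcov' j, fun i p hi =>
      hdown' p i (l + 1) r hr₀ h₂.le (by omega), fun i p hi => ?_⟩
    rcases p with _ | p
    · rw [pow_zero, one_mul]
      rcases hi.eq_or_lt with hi | hi
      · rw [← hi]; simp
      · refine le_trans ?_ hle
        simpa using hup' 0 i l r h₁ (by omega)
    · exact (hup' (p + 1) i l r h₁ (by omega)).trans hle
  · refine ⟨l, fun j => by simpa [max_eq_left hle] using hcov' j, fun i p hi => ?_, fun i p hi =>
      hup' p i l r h₁ (by omega)⟩
    rcases p with _ | p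
    · rw [pow_zero, one_mul]
      rcases hi.eq_or_lt with hi | hi
      · rw [← hi]; simp
      · refine le_trans ?_ hle
        simpa using hdown' 0 i (l + 1) r hr₀ h₂.le (by omega)
    · exact (hdown' (p + 1) i (l + 1) r hr₀ h₂.le (by omega)).trans hle

end IsContactFamily

/-! ### Homogeneous polynomials which are uniformly large on the sphere -/

lemma div_sqrt_pow_le_exp {x : ℝ} (hx : 0 ≤ x) (k : ℕ) :
    (x / √k) ^ k ≤ Real.exp (-(x - √k) ^ 2 / 2 + (x ^ 2 - k) / 2) := by
  rcases Nat.eq_zero_or_pos k with rfl | hk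
  · simp
    ring_nf
    simp
  have hk' : (0 : ℝ) < k := by exact_mod_cast hk
  have hy : 0 < √(k : ℝ) := Real.sqrt_pos.2 hk'
  have hyy : √(k : ℝ) ^ 2 = k := Real.sq_sqrt hk'.le
  calc (x / √k) ^ k ≤ Real.exp (x / √k - 1) ^ k := by
        gcongr
        have := Real.add_one_le_exp (x / √k - 1)
        linarith
    _ = Real.exp (k * (x / √k - 1)) := by rw [← Real.exp_nat_mul]
    _ = _ := by
        congr 1
        have : (k : ℝ) * (x / √k) = x * √k := by
          nth_rewrite 1 [← hyy]; field_simp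
        rw [mul_sub, this]
        nlinarith

lemma exp_le_div_sqrt_pow {x : ℝ} (hx : 0 ≤ x) {k : ℕ} (hxk : x = 0 → k = 0) :
    Real.exp (-((k - x ^ 2) ^ 2 / x ^ 2 + (k - x ^ 2)) / 2) ≤ (x / √k) ^ k := by
  rcases hx.eq_or_lt with rfl | hx
  · simp [hxk rfl]
  rcases Nat.eq_zero_or_pos k with rfl | hk
  · have : (x ^ 2) ^ 2 / x ^ 2 = x ^ 2 := by field_simp
    simp [this]
  have hk' : (0 : ℝ) < k := by exact_mod_cast hk
  have hy : 0 < √(k : ℝ) := Real.sqrt_pos.2 hk'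
  have hyy : √(k : ℝ) ^ 2 = k := Real.sq_sqrt hk'.le
  have h1 : Real.exp ((1 - k / x ^ 2) / 2) ≤ x / √k := by
    refine le_of_pow_le_pow_left₀ two_ne_zero (by positivity) ?_
    rw [← Real.exp_nat_mul, div_pow, hyy]
    have h2 : Real.exp ((2 : ℕ) * ((1 - k / x ^ 2) / 2)) = (Real.exp (k / x ^ 2 - 1))⁻¹ := by
      rw [← Real.exp_neg]; congr 1; push_cast; ring
    rw [h2, ← inv_div (k : ℝ) (x ^ 2)]
    refine inv_anti₀ (by positivity) ?_
    have := Real.add_one_le_exp (k / x ^ 2 - 1 : ℝ)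
    linarith
  calc _ = Real.exp ((1 - k / x ^ 2) / 2) ^ k := by
        rw [← Real.exp_nat_mul]
        congr 1
        field_simp
        ring
    _ ≤ _ := by gcongr

/-- The Gaussian centred at `x` decays geometrically in the distance to `⌊x⌋`. -/
lemma exp_neg_sq_le {x : ℝ} (hx : 0 ≤ x) (m : ℕ) :
    Real.exp (-(x - m) ^ 2 / 2) ≤
      Real.exp 4 * (1 / 4) ^ ((m - ⌊x⌋₊) + (⌊x⌋₊ - m)) := by
  set D := (m - ⌊x⌋₊) + (⌊x⌋₊ - m) with hD
  have hD1 : (D : ℝ) ≤ |x - m| + 1 := by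
    have h₁ := Nat.floor_le hx
    have h₂ := (Nat.lt_floor_add_one x).le
    rcases le_total m ⌊x⌋₊ with hm | hm
    · have : (D : ℝ) = ⌊x⌋₊ - m := by
        rw [hD, Nat.sub_eq_zero_of_le hm, zero_add, Nat.cast_sub hm]
      have := le_abs_self (x - m)
      linarith
    · have : (D : ℝ) = m - ⌊x⌋₊ := by
        rw [hD, Nat.sub_eq_zero_of_le hm, add_zero, Nat.cast_sub hm]
      have := neg_abs_le (x - m)
      linarith
  have he : Real.exp (-2) ≤ 1 / 4 := by
    have : Real.exp (-2) = (Real.exp 1 ^ 2)⁻¹ := by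
      rw [← Real.exp_nat_mul, ← Real.exp_neg]; norm_num
    rw [this, one_div]
    refine inv_anti₀ (by norm_num) ?_
    nlinarith [Real.add_one_le_exp (1 : ℝ)]
  calc Real.exp (-(x - m) ^ 2 / 2) ≤ Real.exp (4 + D * (-2)) := by
        gcongr
        nlinarith [sq_abs (x - m), sq_nonneg (|x - m| - 2)]
    _ = Real.exp 4 * Real.exp (-2) ^ D := by rw [Real.exp_add, Real.exp_nat_mul]
    _ ≤ _ := by gcongr

variable {d : ℕ}

/-- The monomial `z ^ α`, divided by its maximum over the unit sphere if `∑ α = n`. Where `α i = 0`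
the quotient `n / α i` is a junk value, but it is raised to the power `0`. -/
noncomputable def normalizedMonomial (n : ℕ) (α : Fin d → ℕ) (z : Cd d) : ℂ :=
  ∏ i, (((√(n / α i : ℝ) : ℝ) : ℂ) * z i) ^ α i

lemma differentiable_normalizedMonomial (n : ℕ) (α : Fin d → ℕ) :
    Differentiable ℂ (normalizedMonomial n α) := by
  unfold normalizedMonomial
  fun_prop

/-- The exponent `m i ^ 2` at the indices `i ≠ i₀`, with the exponent at `i₀` chosen such that the
total degree is `n`. -/
def squareExponent (n : ℕ) (i₀ : Fin d) (m : Fin d → ℕ) : Fin d → ℕ :=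
  fun i => if i = i₀ then n - ∑ j, m j ^ 2 else m i ^ 2

/-- The vectors `m` in the residue class `b` modulo `L`, with vanishing entry at `i₀`, for which
`squareExponent n i₀ m` has total degree `n`. -/
def residueGrid {L : ℕ} (n : ℕ) (i₀ : Fin d) (b : Fin d → Fin L) : Finset (Fin d → ℕ) :=
  {m ∈ Fintype.piFinset fun i =>
    {k ∈ Finset.range (n + 1) | if i = i₀ then k = 0 else k % L = b i} | ∑ j, m j ^ 2 ≤ n}

/-- A homogeneous polynomial of degree `n` whose monomials have exponents that are spread out: at
the indices `i ≠ i₀`, the square roots of the exponents lie in the residue class `b i` modulo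
`L`. -/
noncomputable def sparsePolynomial {L : ℕ} (i₀ : Fin d) (b : Fin d → Fin L) (n : ℕ) (z : Cd d) :
    ℂ :=
  ∑ m ∈ residueGrid n i₀ b, normalizedMonomial n (squareExponent n i₀ m) z

lemma mem_residueGrid {L n : ℕ} {i₀ : Fin d} {b : Fin d → Fin L} {m : Fin d → ℕ} :
    m ∈ residueGrid n i₀ b ↔ (∀ i, m i ≤ n ∧ if i = i₀ then m i = 0 else m i % L = b i) ∧
      ∑ j, m j ^ 2 ≤ n := by
  simp [residueGrid, Fintype.mem_piFinset]

lemma sum_squareExponent {n : ℕ} {i₀ : Fin d} {m : Fin d → ℕ} (h₀ : m i₀ = 0)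
    (hm : ∑ j, m j ^ 2 ≤ n) : ∑ i, squareExponent n i₀ m i = n := by
  rw [← Finset.add_sum_erase _ _ (Finset.mem_univ i₀)] at hm ⊢
  have : ∑ i ∈ Finset.univ.erase i₀, squareExponent n i₀ m i =
      ∑ i ∈ Finset.univ.erase i₀, m i ^ 2 :=
    Finset.sum_congr rfl fun i hi => by simp [squareExponent, Finset.ne_of_mem_erase hi]
  rw [this, squareExponent, if_pos rfl, ← Finset.add_sum_erase _ _ (Finset.mem_univ i₀)]
  rw [h₀] at hm ⊢
  omega

/-- Polar form of the normalized monomials, where `x i = √n |z i| / |z|`. -/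
lemma exists_norm_normalizedMonomial_eq {n : ℕ} {z : Cd d} (hz : z ≠ 0) :
    ∃ x : Fin d → ℝ, (∀ i, 0 ≤ x i) ∧ ∑ i, x i ^ 2 = n ∧
      ∀ α : Fin d → ℕ, ∑ i, α i = n →
        ‖normalizedMonomial n α z‖ = ‖z‖ ^ n * ∏ i, (x i / √(α i)) ^ α i := by
  have hr : 0 < ‖z‖ := norm_pos_iff.2 hz
  refine ⟨fun i => √n * ‖z i‖ / ‖z‖, fun i => by positivity, ?_, fun α hα => ?_⟩
  · simp_rw [div_pow, mul_pow, Real.sq_sqrt (Nat.cast_nonneg n)]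
    rw [← Finset.sum_div, ← Finset.mul_sum, ← EuclideanSpace.norm_sq_eq]
    field_simp
  · conv_lhs => rw [normalizedMonomial]
    conv_rhs => rw [← hα, ← Finset.prod_pow_eq_pow_sum, hα, ← Finset.prod_mul_distrib]
    rw [norm_prod]
    refine Finset.prod_congr rfl fun i _ => ?_
    rw [norm_pow, norm_mul, Complex.norm_real, Real.norm_of_nonneg (Real.sqrt_nonneg _),
      ← mul_pow, Real.sqrt_div (Nat.cast_nonneg n)]
    congr 1
    field_simp

/-- The values at a point of the monomials in a `sparsePolynomial` decay geometrically away from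
the monomial that peaks next to this point. -/
lemma norm_normalizedMonomial_squareExponent_le {n : ℕ} {x : Fin d → ℝ} (hx : ∀ i, 0 ≤ x i)
    (hxn : ∑ i, x i ^ 2 = n) {i₀ : Fin d} {m : Fin d → ℕ} (h₀ : m i₀ = 0)
    (hm : ∑ j, m j ^ 2 ≤ n) :
    ∏ i, (x i / √(squareExponent n i₀ m i)) ^ squareExponent n i₀ m i ≤
      Real.exp 4 ^ d * ∏ i, (1 / 4 : ℝ) ^
        ((m i - if i = i₀ then 0 else ⌊x i⌋₊) + ((if i = i₀ then 0 else ⌊x i⌋₊) - m i)) := by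
  set α := squareExponent n i₀ m with hα
  have hsum : ∑ i, (α i : ℝ) = n := by exact_mod_cast sum_squareExponent h₀ hm
  calc ∏ i, (x i / √(α i)) ^ α i
      ≤ ∏ i, Real.exp (-(x i - √(α i)) ^ 2 / 2 + (x i ^ 2 - α i) / 2) := by
        refine Finset.prod_le_prod (fun i _ => ?_) fun i _ => div_sqrt_pow_le_exp (hx i) _
        have := hx i
        positivity
    _ = ∏ i, Real.exp (-(x i - √(α i)) ^ 2 / 2) := by
        have h2 : ∑ i, (x i ^ 2 - α i) / 2 = 0 := by
          rw [← Finset.sum_div, Finset.sum_sub_distrib, hxn, hsum, sub_self, zero_div]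
        rw [← Real.exp_sum, ← Real.exp_sum, Finset.sum_add_distrib, h2, add_zero]
    _ ≤ ∏ i, (Real.exp 4 * (1 / 4 : ℝ) ^
          ((m i - if i = i₀ then 0 else ⌊x i⌋₊) + ((if i = i₀ then 0 else ⌊x i⌋₊) - m i))) := by
        refine Finset.prod_le_prod (fun i _ => (Real.exp_pos _).le) fun i _ => ?_
        by_cases hi : i = i₀
        · subst hi
          simp only [if_true, h₀, Nat.sub_zero, add_zero, pow_zero, mul_one]
          gcongr
          nlinarith [sq_nonneg (x i - √(α i))]
        · simp only [if_neg hi]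
          have : √(α i : ℝ) = m i := by
            rw [hα, squareExponent, if_neg hi]
            push_cast
            exact Real.sqrt_sq (Nat.cast_nonneg _)
          rw [this]
          exact exp_neg_sq_le (hx i) _
    _ = _ := by rw [Finset.prod_mul_distrib]; simp

lemma sum_prod_half_pow_dist_le (s : Finset (Fin d → ℕ)) (k : Fin d → ℕ) :
    ∑ m ∈ s, ∏ i, (1 / 2 : ℝ) ^ ((m i - k i) + (k i - m i)) ≤ 4 ^ d := by
  calc ∑ m ∈ s, ∏ i, (1 / 2 : ℝ) ^ ((m i - k i) + (k i - m i))
      ≤ ∑ m ∈ Fintype.piFinset fun i => s.image fun m => m i,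
          ∏ i, (1 / 2 : ℝ) ^ ((m i - k i) + (k i - m i)) :=
        Finset.sum_le_sum_of_subset_of_nonneg
          (fun m hm => Fintype.mem_piFinset.2 fun i => Finset.mem_image_of_mem _ hm)
          fun _ _ _ => Finset.prod_nonneg fun _ _ => by positivity
    _ = ∏ i, ∑ j ∈ s.image fun m => m i, (1 / 2 : ℝ) ^ ((j - k i) + (k i - j)) :=
        (Finset.prod_univ_sum _ fun i j => (1 / 2 : ℝ) ^ ((j - k i) + (k i - j))).symm
    _ ≤ ∏ _i : Fin d, 4 := Finset.prod_le_prod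
        (fun _ _ => Finset.sum_nonneg fun _ _ => by positivity)
        fun i _ => sum_half_pow_dist_le _ _
    _ = 4 ^ d := by simp

lemma differentiable_sparsePolynomial {L : ℕ} (i₀ : Fin d) (b : Fin d → Fin L) (n : ℕ) :
    Differentiable ℂ (sparsePolynomial i₀ b n) := by
  unfold sparsePolynomial
  exact Differentiable.fun_sum fun m _ => differentiable_normalizedMonomial n _

lemma norm_sparsePolynomial_le {L : ℕ} (i₀ : Fin d) (b : Fin d → Fin L) (n : ℕ) (z : Cd d) :
    ‖sparsePolynomial i₀ b n z‖ ≤ Real.exp 4 ^ d * 4 ^ d * ‖z‖ ^ n := by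
  have hne : ∀ z : Cd d, z ≠ 0 →
      ‖sparsePolynomial i₀ b n z‖ ≤ Real.exp 4 ^ d * 4 ^ d * ‖z‖ ^ n := by
    intro z hz
    obtain ⟨x, hx, hxn, hnorm⟩ := exists_norm_normalizedMonomial_eq (n := n) hz
    set k : Fin d → ℕ := fun i => if i = i₀ then 0 else ⌊x i⌋₊ with hk
    calc ‖sparsePolynomial i₀ b n z‖
        ≤ ∑ m ∈ residueGrid n i₀ b, ‖z‖ ^ n * (Real.exp 4 ^ d *
            ∏ i, (1 / 2 : ℝ) ^ ((m i - k i) + (k i - m i))) := by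
          refine norm_sum_le_of_le _ fun m hm => ?_
          rw [mem_residueGrid] at hm
          have h₀ : m i₀ = 0 := by simpa using (hm.1 i₀).2
          rw [hnorm _ (sum_squareExponent h₀ hm.2)]
          gcongr
          refine (norm_normalizedMonomial_squareExponent_le hx hxn h₀ hm.2).trans ?_
          gcongr
          norm_num
      _ ≤ ‖z‖ ^ n * (Real.exp 4 ^ d * 4 ^ d) := by
          rw [← Finset.mul_sum, ← Finset.mul_sum]
          gcongr
          exact sum_prod_half_pow_dist_le _ k
      _ = _ := by ring
  have hclosed : IsClosed {z : Cd d |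
      ‖sparsePolynomial i₀ b n z‖ ≤ Real.exp 4 ^ d * 4 ^ d * ‖z‖ ^ n} :=
    isClosed_le (differentiable_sparsePolynomial i₀ b n).continuous.norm
      (continuous_const.mul (continuous_norm.pow n))
  have : Nonempty (Fin d) := ⟨i₀⟩
  have : (nhdsWithin (0 : Cd d) {0}ᶜ).NeBot := Module.punctured_nhds_neBot ℂ (Cd d) 0
  have hsub := hclosed.closure_subset_iff.2 (show ({0}ᶜ : Set (Cd d)) ⊆ _ from hne)
  rw [(dense_compl_singleton (0 : Cd d)).closure_eq] at hsub
  exact hsub (Set.mem_univ z)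

/-- The exponents whose square roots are next to `x` give a product which is bounded below. The
index `i₀` which absorbs the rounding errors, of order `√n`, has to be one with large `x i₀`. -/
lemma exp_le_prod_div_sqrt_pow {n : ℕ} {x : Fin d → ℝ} (hx : ∀ i, 0 ≤ x i)
    (hxn : ∑ i, x i ^ 2 = n) {i₀ : Fin d} (hi₀ : (n : ℝ) ≤ d * x i₀ ^ 2) {m : Fin d → ℕ}
    (hm : ∀ i, m i = if i = i₀ then 0 else ⌊x i⌋₊) (hmn : ∑ j, m j ^ 2 ≤ n) :
    Real.exp (-(2 * d ^ 4)) ≤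
      ∏ i, (x i / √(squareExponent n i₀ m i)) ^ squareExponent n i₀ m i := by
  set α := squareExponent n i₀ m with hα
  have hd : (1 : ℝ) ≤ d := by exact_mod_cast i₀.pos
  have h₀ : m i₀ = 0 := by simp [hm]
  have hsum : ∑ i, (α i : ℝ) = n := by exact_mod_cast sum_squareExponent h₀ hmn
  have hαi : ∀ i, i ≠ i₀ → (α i : ℝ) = m i ^ 2 := fun i hi => by
    rw [hα, squareExponent, if_neg hi]; push_cast; rfl
  have hround : ∀ i, i ≠ i₀ → |α i - x i ^ 2| ≤ 2 * x i := by
    intro i hi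
    have e₁ : (m i : ℝ) ≤ x i := by rw [hm, if_neg hi]; exact Nat.floor_le (hx i)
    have e₂ : x i ≤ m i + 1 := by rw [hm, if_neg hi]; exact (Nat.lt_floor_add_one _).le
    have e₃ : (0 : ℝ) ≤ m i := Nat.cast_nonneg _
    rw [hαi i hi, abs_le]
    constructor <;> nlinarith [hx i]
  have hxi : ∀ i, x i ^ 2 ≤ n := fun i => by
    rw [← hxn]
    exact Finset.single_le_sum (f := fun i => x i ^ 2) (fun i _ => sq_nonneg _)
      (Finset.mem_univ i)
  have hround₀ : |α i₀ - x i₀ ^ 2| ≤ d * (2 * √n) := by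
    have e₁ : (α i₀ : ℝ) - x i₀ ^ 2 = -∑ i ∈ Finset.univ.erase i₀, (α i - x i ^ 2) := by
      have := Finset.add_sum_erase Finset.univ (fun i => (α i : ℝ) - x i ^ 2) (Finset.mem_univ i₀)
      rw [Finset.sum_sub_distrib (s := Finset.univ), hsum, hxn] at this
      linarith
    rw [e₁, abs_neg]
    calc _ ≤ ∑ i ∈ Finset.univ.erase i₀, |α i - x i ^ 2| := Finset.abs_sum_le_sum_abs _ _
      _ ≤ ∑ i ∈ Finset.univ.erase i₀, 2 * √n := Finset.sum_le_sum fun i hi =>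
          (hround i (Finset.ne_of_mem_erase hi)).trans <| by
            gcongr
            exact Real.le_sqrt_of_sq_le (hxi i)
      _ ≤ ∑ i : Fin d, 2 * √n := Finset.sum_le_sum_of_subset_of_nonneg
          (Finset.erase_subset _ _) fun _ _ _ => by positivity
      _ = d * (2 * √n) := by simp
  have hzero : ∀ i, x i = 0 → α i = 0 := by
    intro i hi
    by_cases hii : i = i₀
    · subst hii
      have : (n : ℝ) = 0 := le_antisymm (by simpa [hi] using hi₀) (Nat.cast_nonneg n)
      have hn : n = 0 := by exact_mod_cast this
      simp [hα, squareExponent, hn]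
    · have := hround i hii
      rw [hi] at this
      simpa using this
  have hquot : ∀ i, (α i - x i ^ 2) ^ 2 / x i ^ 2 ≤ 4 * (d : ℝ) ^ 3 := by
    intro i
    rcases (hx i).eq_or_lt with h | h
    · rw [← h]; simp
    rw [div_le_iff₀ (by positivity)]
    by_cases hi : i = i₀
    · subst hi
      calc (α i - x i ^ 2) ^ 2 ≤ (d * (2 * √n)) ^ 2 := sq_le_sq' (abs_le.1 hround₀).1
            (abs_le.1 hround₀).2
        _ = 4 * d ^ 2 * n := by rw [mul_pow, mul_pow, Real.sq_sqrt (Nat.cast_nonneg n)]; ring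
        _ ≤ 4 * d ^ 2 * (d * x i ^ 2) := by gcongr
        _ = _ := by ring
    · calc (α i - x i ^ 2) ^ 2 ≤ (2 * x i) ^ 2 := sq_le_sq' (abs_le.1 (hround i hi)).1
            (abs_le.1 (hround i hi)).2
        _ = 4 * 1 * x i ^ 2 := by ring
        _ ≤ 4 * d ^ 3 * x i ^ 2 := by
            gcongr
            exact one_le_pow₀ hd
  calc Real.exp (-(2 * d ^ 4))
      ≤ Real.exp (∑ i, -((α i - x i ^ 2) ^ 2 / x i ^ 2 + (α i - x i ^ 2)) / 2) := by
        gcongr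
        rw [← Finset.sum_div, Finset.sum_neg_distrib, Finset.sum_add_distrib,
          Finset.sum_sub_distrib (f := fun i => (α i : ℝ)), hsum, hxn]
        have := Finset.sum_le_sum fun i (_ : i ∈ Finset.univ) => hquot i
        rw [Finset.sum_const, Finset.card_univ, Fintype.card_fin, nsmul_eq_mul] at this
        nlinarith
    _ = ∏ i, Real.exp (-((α i - x i ^ 2) ^ 2 / x i ^ 2 + (α i - x i ^ 2)) / 2) :=
        Real.exp_sum _ _
    _ ≤ _ := Finset.prod_le_prod (fun i _ => (Real.exp_pos _).le) fun i _ =>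
        exp_le_div_sqrt_pow (hx i) (hzero i)

/-- At every point of the sphere one of the finitely many polynomials `sparsePolynomial i₀ b n` is
bounded below, up to an error which is small for large `L`. -/
lemma exists_le_norm_sparsePolynomial {L : ℕ} (hL : 0 < L) (n : ℕ) {z : Cd d} (hz : z ≠ 0) :
    ∃ (i₀ : Fin d) (b : Fin d → Fin L),
      (Real.exp (-(2 * d ^ 4)) - Real.exp 4 ^ d * 4 ^ d * (1 / 2) ^ L) * ‖z‖ ^ n ≤
        ‖sparsePolynomial i₀ b n z‖ := by
  obtain ⟨x, hx, hxn, hnorm⟩ := exists_norm_normalizedMonomial_eq (n := n) hz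
  have hne : (Finset.univ : Finset (Fin d)).Nonempty := by
    by_contra hcon
    rw [Finset.not_nonempty_iff_eq_empty, Finset.univ_eq_empty_iff] at hcon
    exact hz (Subsingleton.elim _ _)
  obtain ⟨i₀, -, hmax⟩ := Finset.exists_max_image Finset.univ x hne
  have hi₀ : (n : ℝ) ≤ d * x i₀ ^ 2 := by
    rw [← hxn]
    calc ∑ i, x i ^ 2 ≤ ∑ _i : Fin d, x i₀ ^ 2 := Finset.sum_le_sum fun i hi =>
          pow_le_pow_left₀ (hx i) (hmax i hi) 2
      _ = _ := by simp
  set k : Fin d → ℕ := fun i => if i = i₀ then 0 else ⌊x i⌋₊ with hk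
  have hkx : ∀ i, (k i : ℝ) ≤ x i := fun i => by
    by_cases hi : i = i₀
    · simp [hk, hi, hx]
    · simpa [hk, hi] using Nat.floor_le (hx i)
  have hkn : ∑ j, k j ^ 2 ≤ n := by
    have : ∑ j, (k j : ℝ) ^ 2 ≤ n := by
      rw [← hxn]
      exact Finset.sum_le_sum fun i _ => pow_le_pow_left₀ (Nat.cast_nonneg _) (hkx i) 2
    exact_mod_cast this
  have hk₀ : k i₀ = 0 := by simp [hk]
  refine ⟨i₀, fun i => ⟨k i % L, Nat.mod_lt _ hL⟩, ?_⟩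
  set b : Fin d → Fin L := fun i => ⟨k i % L, Nat.mod_lt _ hL⟩ with hb
  have hkmem : k ∈ residueGrid n i₀ b := by
    refine mem_residueGrid.2 ⟨fun i => ⟨?_, ?_⟩, hkn⟩
    · calc k i ≤ k i ^ 2 := Nat.le_self_pow two_ne_zero _
        _ ≤ ∑ j, k j ^ 2 := Finset.single_le_sum (f := fun j => k j ^ 2)
            (fun _ _ => Nat.zero_le _) (Finset.mem_univ i)
        _ ≤ n := hkn
    · by_cases hi : i = i₀
      · simp [hi, hk₀]
      · simp [hi, hb]
  rw [sparsePolynomial, ← Finset.add_sum_erase _ _ hkmem]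
  have hmain : Real.exp (-(2 * d ^ 4)) * ‖z‖ ^ n ≤
      ‖normalizedMonomial n (squareExponent n i₀ k) z‖ := by
    rw [hnorm _ (sum_squareExponent hk₀ hkn), mul_comm]
    gcongr
    exact exp_le_prod_div_sqrt_pow hx hxn hi₀ (fun i => rfl) hkn
  have hrest : ‖∑ m ∈ (residueGrid n i₀ b).erase k,
      normalizedMonomial n (squareExponent n i₀ m) z‖ ≤
        Real.exp 4 ^ d * 4 ^ d * (1 / 2) ^ L * ‖z‖ ^ n := by
    calc _ ≤ ∑ m ∈ (residueGrid n i₀ b).erase k, ‖z‖ ^ n * (Real.exp 4 ^ d * ((1 / 2) ^ L *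
            ∏ i, (1 / 2 : ℝ) ^ ((m i - k i) + (k i - m i)))) := by
          refine norm_sum_le_of_le _ fun m hm => ?_
          have hmk := Finset.ne_of_mem_erase hm
          have hm := mem_residueGrid.1 (Finset.mem_of_mem_erase hm)
          have h₀ : m i₀ = 0 := by simpa using (hm.1 i₀).2
          rw [hnorm _ (sum_squareExponent h₀ hm.2)]
          gcongr
          refine (norm_normalizedMonomial_squareExponent_le hx hxn h₀ hm.2).trans ?_
          gcongr
          -- Some entry of `m` differs from that of `k`, hence by at least `L`.
          obtain ⟨i, hi⟩ := Function.ne_iff.1 hmk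
          have hii : i ≠ i₀ := by
            rintro rfl
            exact hi (h₀.trans hk₀.symm)
          have hmod : m i % L = k i % L := by simpa [hii, hb] using (hm.1 i).2
          have hL' : L ≤ (m i - k i) + (k i - m i) := by
            rcases le_total (m i) (k i) with hle | hle
            · have := Nat.le_of_dvd (by omega) ((Nat.modEq_iff_dvd' hle).1 hmod)
              omega
            · have := Nat.le_of_dvd (by omega) ((Nat.modEq_iff_dvd' hle).1 hmod.symm)
              omega
          have hquarter : ∀ j : ℕ, (1 / 4 : ℝ) ^ j = (1 / 2) ^ j * (1 / 2) ^ j := fun j => by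
            rw [← mul_pow]; norm_num
          change ∏ j, (1 / 4 : ℝ) ^ ((m j - k j) + (k j - m j)) ≤ _
          simp_rw [hquarter]
          rw [Finset.prod_mul_distrib]
          gcongr
          rw [Finset.prod_pow_eq_pow_sum]
          refine pow_le_pow_of_le_one (by norm_num) (by norm_num) (hL'.trans ?_)
          exact Finset.single_le_sum (f := fun j => (m j - k j) + (k j - m j))
            (fun _ _ => Nat.zero_le _) (Finset.mem_univ i)
      _ ≤ ‖z‖ ^ n * (Real.exp 4 ^ d * ((1 / 2) ^ L * 4 ^ d)) := by
          rw [← Finset.mul_sum, ← Finset.mul_sum, ← Finset.mul_sum]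
          gcongr
          exact sum_prod_half_pow_dist_le _ k
      _ = _ := by ring
  have htri := norm_sub_le_norm_add (normalizedMonomial n (squareExponent n i₀ k) z)
    (∑ m ∈ (residueGrid n i₀ b).erase k, normalizedMonomial n (squareExponent n i₀ m) z)
  rw [sub_mul]
  linarith

/-- Finitely many sequences of homogeneous polynomials which are bounded on the unit sphere,
uniformly in the degree `n`, and whose maximum is bounded below there. -/
lemma exists_homogeneous_family (d : ℕ) :
    ∃ (J : Type) (_ : Fintype J) (W : J → ℕ → Cd d → ℂ) (c C : ℝ), 0 < c ∧ 0 < C ∧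
      (∀ j n, Differentiable ℂ (W j n)) ∧ (∀ j n z, ‖W j n z‖ ≤ C * ‖z‖ ^ n) ∧
      ∀ n z, z ≠ 0 → ∃ j, c * ‖z‖ ^ n ≤ ‖W j n z‖ := by
  have hC : 0 < Real.exp 4 ^ d * 4 ^ d := by positivity
  obtain ⟨L, hL⟩ := exists_pow_lt_of_lt_one (div_pos (Real.exp_pos (-(2 * d ^ 4))) hC)
    (by norm_num : (1 / 2 : ℝ) < 1)
  rw [lt_div_iff₀ hC] at hL
  have hL' : (1 / 2 : ℝ) ^ (L + 1) ≤ (1 / 2) ^ L :=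
    pow_le_pow_of_le_one (by norm_num) (by norm_num) L.le_succ
  refine ⟨Fin d × (Fin d → Fin (L + 1)), inferInstance, fun j => sparsePolynomial j.1 j.2,
    Real.exp (-(2 * d ^ 4)) - Real.exp 4 ^ d * 4 ^ d * (1 / 2) ^ (L + 1),
    Real.exp 4 ^ d * 4 ^ d, ?_, hC, fun j n => differentiable_sparsePolynomial _ _ n,
    fun j n z => norm_sparsePolynomial_le _ _ n z, fun n z hz => ?_⟩
  · have := mul_le_mul_of_nonneg_left hL' hC.le
    linarith
  · obtain ⟨i₀, b, h⟩ := exists_le_norm_sparsePolynomial L.succ_pos n hz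
    exact ⟨(i₀, b), h⟩

/-! ### Finitely many functions which majorize the associated weight -/

lemma mem_growthSpace_of_norm_le {ω : ℝ≥0 → ℝ} (hω : IsWeightFunction ω) {f : Cd d → ℂ}
    (hf : Differentiable ℂ f) {M R : ℝ} (hM : ∀ z, R ≤ ‖z‖ → ‖f z‖ ≤ M * ω ‖z‖₊) :
    f ∈ growthSpace d ω hω := by
  obtain ⟨B, hB⟩ := (isCompact_closedBall (0 : Cd d) R).exists_bound_of_continuousOn
    hf.continuous.continuousOn
  refine ⟨hf, max M (B / ω 0), ?_⟩
  rintro _ ⟨z, rfl⟩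
  rcases le_total R ‖z‖ with hz | hz
  · exact le_max_of_le_left ((div_le_iff₀ (hω.pos _)).2 (hM z hz))
  · have hBz := hB z (by simpa using hz)
    exact le_max_of_le_right (div_le_div₀ ((norm_nonneg _).trans hBz) hBz (hω.pos 0)
      (hω.monotone zero_le))

lemma associatedWeightFunction_nonneg (v : ℝ≥0 → ℝ) (t : ℝ≥0) :
    0 ≤ associatedWeightFunction v t := by
  refine Real.sSup_nonneg ?_
  rintro _ ⟨f, -, -, rfl⟩
  exact norm_nonneg _

lemma associatedWeightFunction_le_self {ω : ℝ≥0 → ℝ} (hω : IsWeightFunction ω) (t : ℝ≥0) :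
    associatedWeightFunction ω t ≤ ω t := by
  refine Real.sSup_le ?_ (hω.pos t).le
  rintro _ ⟨f, -, hf, rfl⟩
  simpa using hf ((t : ℝ) : ℂ)

/-- The associated weight majorizes the growth space: restrict to complex lines through `0`. -/
lemma norm_le_mul_associatedWeightFunction {ω : ℝ≥0 → ℝ} (hω : IsWeightFunction ω)
    {f : Cd d → ℂ} (hf : Differentiable ℂ f) {A : ℝ} (hA : 0 < A)
    (hfA : ∀ z, ‖f z‖ ≤ A * ω ‖z‖₊) (z : Cd d) :
    ‖f z‖ ≤ A * associatedWeightFunction ω ‖z‖₊ := by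
  have hbdd : BddAbove {r : ℝ | ∃ g : ℂ → ℂ, Differentiable ℂ g ∧ (∀ w, ‖g w‖ ≤ ω ‖w‖₊) ∧
      r = ‖g (((‖z‖₊ : ℝ≥0) : ℝ) : ℂ)‖} := by
    refine ⟨ω ‖z‖₊, ?_⟩
    rintro _ ⟨g, -, hg, rfl⟩
    simpa using hg (((‖z‖₊ : ℝ≥0) : ℝ) : ℂ)
  -- For `z = 0` the direction `u` is the junk value `0`, which is harmless.
  set u : Cd d := ((‖z‖ : ℂ)⁻¹) • z with hu
  have hu1 : ‖u‖₊ ≤ 1 := by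
    rw [← NNReal.coe_le_coe, coe_nnnorm, hu, norm_smul, norm_inv, Complex.norm_real, norm_norm]
    exact inv_mul_le_one
  have huz : (((‖z‖₊ : ℝ≥0) : ℝ) : ℂ) • u = z := by
    rcases eq_or_ne z 0 with rfl | hz
    · simp
    · have : (‖z‖ : ℂ) ≠ 0 := by exact_mod_cast norm_ne_zero_iff.2 hz
      rw [hu, coe_nnnorm, smul_smul, mul_inv_cancel₀ this, one_smul]
  rw [← div_le_iff₀' hA]
  refine le_csSup hbdd ⟨fun w => (A : ℂ)⁻¹ * f (w • u), ?_, fun w => ?_, ?_⟩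
  · exact (hf.comp (differentiable_id.smul_const u)).const_mul _
  · rw [norm_mul, norm_inv, Complex.norm_real, Real.norm_of_nonneg hA.le, inv_mul_le_iff₀ hA]
    refine (hfA _).trans ?_
    gcongr
    refine hω.monotone ?_
    rw [nnnorm_smul]
    exact mul_le_of_le_one_right zero_le hu1
  · dsimp only
    rw [huz, norm_mul, norm_inv, Complex.norm_real, Real.norm_of_nonneg hA.le]
    ring

/-- The series `∑ p, a (n q) * W (n q) z` over the indices `q = 3 * p + i`. Only every third member
of the sparse subfamily is used, so that one summand can outweigh all the others together. -/
noncomputable def lacunarySeries (a : ℕ → ℝ) (n : ℕ → ℕ) (W : ℕ → Cd d → ℂ) (i : ℕ) (z : Cd d) :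
    ℂ :=
  ∑' p, (a (n (3 * p + i)) : ℂ) * W (n (3 * p + i)) z

namespace IsContactFamily

variable {a ρ : ℕ → ℝ} (h : IsContactFamily a ρ) {n : ℕ → ℕ} {W : ℕ → Cd d → ℂ} {C : ℝ}
include h

lemma norm_lacunarySeries_term_le (hWC : ∀ m z, ‖W m z‖ ≤ C * ‖z‖ ^ m) (q : ℕ) (z : Cd d) :
    ‖(a (n q) : ℂ) * W (n q) z‖ ≤ C * (a (n q) * ‖z‖ ^ n q) := by
  rw [norm_mul, Complex.norm_real, Real.norm_of_nonneg (h.coeff_pos _).le]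
  calc _ ≤ a (n q) * (C * ‖z‖ ^ n q) := mul_le_mul_of_nonneg_left (hWC _ z) (h.coeff_pos _).le
    _ = _ := by ring

lemma summable_lacunarySeries_bound (hρ : Tendsto ρ atTop atTop) (hn : StrictMono n) (i : ℕ)
    {R : ℝ} (hR : 0 ≤ R) :
    Summable fun p => C * (a (n (3 * p + i)) * R ^ n (3 * p + i)) := by
  have hinj : Function.Injective fun p => n (3 * p + i) := hn.injective.comp fun p q hpq => by
    omega
  exact ((h.summable_mul_pow hρ hR).comp_injective hinj).mul_left C

lemma differentiable_lacunarySeries (hρ : Tendsto ρ atTop atTop) (hn : StrictMono n)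
    (hC : 0 ≤ C) (hW : ∀ m, Differentiable ℂ (W m)) (hWC : ∀ m z, ‖W m z‖ ≤ C * ‖z‖ ^ m)
    (i : ℕ) : Differentiable ℂ (lacunarySeries a n W i) := by
  refine differentiable_tsum_of_summable_on_balls
    (u := fun R p => C * (a (n (3 * p + i)) * (max R 0) ^ n (3 * p + i)))
    (fun p => (hW _).const_mul _)
    (fun R => h.summable_lacunarySeries_bound hρ hn i (le_max_right R 0)) fun R p z hz => ?_
  refine (h.norm_lacunarySeries_term_le hWC _ z).trans ?_
  have := (h.coeff_pos (n (3 * p + i))).le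
  gcongr
  exact hz.trans (le_max_left R 0)

lemma hasSum_lacunarySeries (hρ : Tendsto ρ atTop atTop) (hn : StrictMono n)
    (hWC : ∀ m z, ‖W m z‖ ≤ C * ‖z‖ ^ m) (i : ℕ) (z : Cd d) :
    HasSum (fun p => (a (n (3 * p + i)) : ℂ) * W (n (3 * p + i)) z) (lacunarySeries a n W i z) :=
  (Summable.of_norm_bounded (h.summable_lacunarySeries_bound hρ hn i (norm_nonneg z))
    fun _ => h.norm_lacunarySeries_term_le hWC _ z).hasSum

/-- If the terms decay away from the `k`-th one, the lacunary series is dominated by this term. -/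
lemma norm_lacunarySeries_le (hρ : Tendsto ρ atTop atTop) (hn : StrictMono n)
    (hC : 0 ≤ C) (hWC : ∀ m z, ‖W m z‖ ≤ C * ‖z‖ ^ m) {K : ℝ} (hK : 2 ≤ K) {i : ℕ} (hi : i < 3)
    {z : Cd d} {k : ℕ}
    (hk₁ : ∀ i p, k + 3 * p ≤ i → K ^ p * (a (n i) * ‖z‖ ^ n i) ≤ a (n k) * ‖z‖ ^ n k)
    (hk₂ : ∀ i p, i + 3 * p ≤ k → K ^ p * (a (n i) * ‖z‖ ^ n i) ≤ a (n k) * ‖z‖ ^ n k) :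
    ‖lacunarySeries a n W i z‖ ≤ 8 * C * (a (n k) * ‖z‖ ^ n k) := by
  have hT : ∀ q, 0 ≤ a (n q) * ‖z‖ ^ n q := fun q =>
    mul_nonneg (h.coeff_pos _).le (by positivity)
  refine le_of_tendsto (h.hasSum_lacunarySeries hρ hn hWC i z).norm
    (Eventually.of_forall fun s => ?_)
  calc _ ≤ ∑ p ∈ s, 2 * C * (a (n k) * ‖z‖ ^ n k) *
          (1 / 2 : ℝ) ^ ((p - k / 3) + (k / 3 - p)) := by
        refine norm_sum_le_of_le _ fun p _ => (h.norm_lacunarySeries_term_le hWC _ z).trans ?_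
        set D := (p - k / 3) + (k / 3 - p)
        -- `p` and `k / 3` differ by `D`, so the indices differ by more than `3 * (D - 1)`.
        have h₁ : K ^ (D - 1) * (a (n (3 * p + i)) * ‖z‖ ^ n (3 * p + i)) ≤
            a (n k) * ‖z‖ ^ n k := by
          rcases Nat.lt_trichotomy p (k / 3) with hp | hp | hp
          · exact hk₂ _ _ (by omega)
          · rcases le_total k (3 * p + i) with hq | hq
            · exact hk₁ _ _ (by omega)
            · exact hk₂ _ _ (by omega)
          · exact hk₁ _ _ (by omega)
        have h₂ : (2 : ℝ) ^ (D - 1) * (a (n (3 * p + i)) * ‖z‖ ^ n (3 * p + i)) ≤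
            a (n k) * ‖z‖ ^ n k :=
          (mul_le_mul_of_nonneg_right (pow_le_pow_left₀ two_pos.le hK _) (hT _)).trans h₁
        have h₃ : (1 : ℝ) ≤ 2 * (1 / 2) ^ D * 2 ^ (D - 1) := by
          rcases Nat.eq_zero_or_pos D with h0 | h0
          · rw [h0]; norm_num
          · obtain ⟨e, he⟩ := Nat.exists_eq_add_of_le h0
            rw [he, Nat.add_sub_cancel_left, pow_add, one_div, inv_pow, inv_pow]
            apply le_of_eq
            field_simp
            norm_num
        calc C * (a (n (3 * p + i)) * ‖z‖ ^ n (3 * p + i))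
            ≤ C * ((2 * (1 / 2) ^ D * 2 ^ (D - 1)) *
                (a (n (3 * p + i)) * ‖z‖ ^ n (3 * p + i))) :=
              mul_le_mul_of_nonneg_left (le_mul_of_one_le_left (hT _) h₃) hC
          _ = 2 * C * (1 / 2) ^ D *
                (2 ^ (D - 1) * (a (n (3 * p + i)) * ‖z‖ ^ n (3 * p + i))) := by ring
          _ ≤ 2 * C * (1 / 2) ^ D * (a (n k) * ‖z‖ ^ n k) := by gcongr
          _ = _ := by ring
    _ ≤ 2 * C * (a (n k) * ‖z‖ ^ n k) * 4 := by
        rw [← Finset.mul_sum]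
        have := hT k
        gcongr
        exact sum_half_pow_dist_le _ _
    _ = _ := by ring

/-- If the terms decay away from the `k`-th one, this term cannot be cancelled by the other terms
of its residue class. -/
lemma le_norm_lacunarySeries (hρ : Tendsto ρ atTop atTop) (hn : StrictMono n)
    (hC : 0 ≤ C) (hWC : ∀ m z, ‖W m z‖ ≤ C * ‖z‖ ^ m) {K c : ℝ} (hK : 2 ≤ K)
    (hKC : 16 * C ≤ c * K) {z : Cd d} {k : ℕ} (hc : c * ‖z‖ ^ n k ≤ ‖W (n k) z‖)
    (hk₁ : ∀ i p, k + 3 * p ≤ i → K ^ p * (a (n i) * ‖z‖ ^ n i) ≤ a (n k) * ‖z‖ ^ n k)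
    (hk₂ : ∀ i p, i + 3 * p ≤ k → K ^ p * (a (n i) * ‖z‖ ^ n i) ≤ a (n k) * ‖z‖ ^ n k) :
    c / 2 * (a (n k) * ‖z‖ ^ n k) ≤ ‖lacunarySeries a n W (k % 3) z‖ := by
  have hK0 : 0 < K := two_pos.trans_le hK
  have hT : ∀ q, 0 ≤ a (n q) * ‖z‖ ^ n q := fun q =>
    mul_nonneg (h.coeff_pos _).le (by positivity)
  refine ge_of_tendsto (h.hasSum_lacunarySeries hρ hn hWC (k % 3) z).norm ?_
  filter_upwards [eventually_ge_atTop {k / 3}] with s hs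
  rw [← Finset.add_sum_erase _ _ (Finset.singleton_subset_iff.1 hs), Nat.div_add_mod]
  have hmain : c * (a (n k) * ‖z‖ ^ n k) ≤ ‖(a (n k) : ℂ) * W (n k) z‖ := by
    rw [norm_mul, Complex.norm_real, Real.norm_of_nonneg (h.coeff_pos _).le]
    calc _ = a (n k) * (c * ‖z‖ ^ n k) := by ring
      _ ≤ _ := mul_le_mul_of_nonneg_left hc (h.coeff_pos _).le
  have hrest : ‖∑ p ∈ s.erase (k / 3), (a (n (3 * p + k % 3)) : ℂ) * W (n (3 * p + k % 3)) z‖ ≤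
      c / 2 * (a (n k) * ‖z‖ ^ n k) := by
    calc _ ≤ ∑ p ∈ s.erase (k / 3), 2 * C / K * (a (n k) * ‖z‖ ^ n k) *
            (1 / 2 : ℝ) ^ ((p - k / 3) + (k / 3 - p)) := by
          refine norm_sum_le_of_le _ fun p hp =>
            (h.norm_lacunarySeries_term_le hWC _ z).trans ?_
          have hp := Finset.ne_of_mem_erase hp
          obtain ⟨e, he⟩ : ∃ e, (p - k / 3) + (k / 3 - p) = e + 1 :=
            Nat.exists_eq_succ_of_ne_zero (by omega)
          rw [he]
          have h₁ : K ^ (e + 1) * (a (n (3 * p + k % 3)) * ‖z‖ ^ n (3 * p + k % 3)) ≤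
              a (n k) * ‖z‖ ^ n k := by
            rcases Nat.lt_or_gt_of_ne hp with hp | hp
            · exact hk₂ _ _ (by omega)
            · exact hk₁ _ _ (by omega)
          have h₂ : K * 2 ^ e * (a (n (3 * p + k % 3)) * ‖z‖ ^ n (3 * p + k % 3)) ≤
              a (n k) * ‖z‖ ^ n k := by
            refine le_trans (mul_le_mul_of_nonneg_right ?_ (hT _)) h₁
            rw [pow_succ, mul_comm]
            gcongr
          calc C * (a (n (3 * p + k % 3)) * ‖z‖ ^ n (3 * p + k % 3))
              = 2 * C / K * (1 / 2) ^ (e + 1) *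
                  (K * 2 ^ e * (a (n (3 * p + k % 3)) * ‖z‖ ^ n (3 * p + k % 3))) := by
                rw [pow_succ, one_div, inv_pow]; field_simp
            _ ≤ 2 * C / K * (1 / 2) ^ (e + 1) * (a (n k) * ‖z‖ ^ n k) := by gcongr
            _ = _ := by ring
      _ ≤ 2 * C / K * (a (n k) * ‖z‖ ^ n k) * 4 := by
          rw [← Finset.mul_sum]
          have := hT k
          gcongr
          exact sum_half_pow_dist_le _ _
      _ = 8 * C / K * (a (n k) * ‖z‖ ^ n k) := by ring
      _ ≤ _ := by
          refine mul_le_mul_of_nonneg_right ?_ (hT k)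
          rw [div_le_iff₀ hK0]
          linarith
  have htri := norm_sub_le_norm_add ((a (n k) : ℂ) * W (n k) z)
    (∑ p ∈ s.erase (k / 3), (a (n (3 * p + k % 3)) : ℂ) * W (n (3 * p + k % 3)) z)
  linarith

end IsContactFamily

/-- Finitely many elements of the growth space majorize the associated weight: at every point, up to
a constant, one of them does. -/
lemma exists_finite_majorizing_family (d : ℕ) {ω : ℝ≥0 → ℝ} (hω : IsWeightFunction ω) :
    ∃ (I : Type) (_ : Fintype I) (F : I → Cd d → ℂ) (A : ℝ), (∀ i, F i ∈ growthSpace d ω hω) ∧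
      ∀ z, ∃ i, associatedWeightFunction ω ‖z‖₊ ≤ A * ‖F i z‖ := by
  obtain ⟨J, _, W, c, C, hc, hC, hW, hWC, hWc⟩ := exists_homogeneous_family d
  obtain ⟨a, ρ, h, hρ, hle, heq⟩ := exists_contactFamily hω
  set K := max 2 (16 * C / c)
  have hK : 2 ≤ K := le_max_left _ _
  have hKC : 16 * C ≤ c * K := by
    rw [← div_le_iff₀' hc]; exact le_max_right _ _
  obtain ⟨n, hn, hsparse⟩ := h.exists_sparse hρ (one_le_two.trans hK)
  -- The constant function `1` takes care of the points with `|z| ≤ ρ 0`.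
  refine ⟨Option (Fin 3 × J), inferInstance,
    fun i => i.elim (fun _ => 1) fun i => lacunarySeries a n (W i.2) i.1,
    max (ω (ρ 0).toNNReal) (8 * K / c), ?_, fun z => ?_⟩
  · rintro (_ | ⟨i, j⟩)
    · refine mem_growthSpace_of_norm_le hω (differentiable_const 1) (M := (ω 0)⁻¹) (R := 0)
        fun z _ => ?_
      change ‖(1 : ℂ)‖ ≤ _
      rw [norm_one, inv_mul_eq_div]
      exact (one_le_div (hω.pos 0)).2 (hω.monotone zero_le)
    · refine mem_growthSpace_of_norm_le hω
        (h.differentiable_lacunarySeries hρ hn hC.le (hW j) (hWC j) i) (M := 8 * C) (R := ρ 0)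
        fun z hz => ?_
      obtain ⟨k, -, hk₁, hk₂⟩ := hsparse _ hz
      refine (h.norm_lacunarySeries_le hρ hn hC.le (hWC j) hK i.2 hk₁ hk₂).trans ?_
      gcongr
      simpa using hle (n k) ‖z‖ ((h.one_le 0).trans hz)
  · rcases le_total (ρ 0) ‖z‖ with hz | hz
    · have hz0 : z ≠ 0 := norm_pos_iff.1 ((h.pos 0).trans_le hz)
      obtain ⟨k, hmax, hk₁, hk₂⟩ := hsparse _ hz
      obtain ⟨j, hj⟩ := hWc (n k) z hz0
      obtain ⟨N, hN₁, hN₂⟩ := exists_le_lt_succ_of_tendsto_atTop hρ hz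
      refine ⟨some (⟨k % 3, Nat.mod_lt _ three_pos⟩, j), ?_⟩
      have h₁ := h.le_norm_lacunarySeries hρ hn hC.le (hWC j) hK hKC hj hk₁ hk₂
      have h₂ := associatedWeightFunction_le hω h heq (t := ‖z‖₊) hN₁ hN₂.le
      rw [coe_nnnorm] at h₂
      have h₃ := hmax N
      have h₄ := hmax (N + 1)
      calc associatedWeightFunction ω ‖z‖₊ ≤ 4 * K * (a (n k) * ‖z‖ ^ n k) := by linarith
        _ = 8 * K / c * (c / 2 * (a (n k) * ‖z‖ ^ n k)) := by field_simp; ring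
        _ ≤ 8 * K / c * ‖lacunarySeries a n (W j) (k % 3) z‖ := by gcongr
        _ ≤ _ := mul_le_mul_of_nonneg_right (le_max_right _ _) (norm_nonneg _)
    · refine ⟨none, ?_⟩
      simp only [Option.elim_none, norm_one, mul_one]
      refine (associatedWeightFunction_le_self hω _).trans (le_max_of_le_left (hω.monotone ?_))
      rw [← norm_toNNReal]
      exact Real.toNNReal_le_toNNReal hz

end GrowthSpaces

theorem corollary3p1 (d : ℕ) (hd : 1 ≤ d) (ω : ℝ≥0 → ℝ)
    (hω : GrowthSpaces.IsWeightFunction ω)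
    (μ : Measure (GrowthSpaces.Cd d)) (q : ℝ) (hq : 0 < q) :
    GrowthSpaces.IsCarleson q (GrowthSpaces.growthSpace d ω hω) μ ↔
      ∫⁻ z, ENNReal.ofReal (GrowthSpaces.associatedWeightFunction ω ‖z‖₊ ^ q) ∂μ < ∞ := by
  have hq0 : ENNReal.ofReal q ≠ 0 := by simpa using hq
  have hqr : (ENNReal.ofReal q).toReal = q := ENNReal.toReal_ofReal hq.le
  have hofReal : ∀ {x A y : ℝ}, 0 ≤ x → 0 ≤ A → 0 ≤ y → x ≤ A * y →
      ENNReal.ofReal (x ^ q) ≤ ENNReal.ofReal (A ^ q) * ENNReal.ofReal (y ^ q) := by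
    intro x A y hx hA hy hxy
    rw [← ENNReal.ofReal_mul (Real.rpow_nonneg hA q), ← Real.mul_rpow hA hy]
    exact ENNReal.ofReal_le_ofReal (Real.rpow_le_rpow hx hxy hq.le)
  have henorm : ∀ y : ℂ, ENNReal.ofReal (‖y‖ ^ q) = ‖y‖ₑ ^ q := fun y => by
    rw [← ENNReal.ofReal_rpow_of_nonneg (norm_nonneg y) hq.le, ofReal_norm]
  constructor
  · intro hμ
    obtain ⟨I, _, F, A, hF, hFA⟩ := GrowthSpaces.exists_finite_majorizing_family d hω
    have hA : 0 ≤ max A 0 := le_max_right A 0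
    calc ∫⁻ z, ENNReal.ofReal (GrowthSpaces.associatedWeightFunction ω ‖z‖₊ ^ q) ∂μ
        ≤ ∫⁻ z, ∑ i, ENNReal.ofReal (max A 0 ^ q) * ‖F i z‖ₑ ^ q ∂μ := by
          refine lintegral_mono fun z => ?_
          obtain ⟨i, hi⟩ := hFA z
          refine (hofReal (GrowthSpaces.associatedWeightFunction_nonneg _ _) hA (norm_nonneg _)
            (hi.trans (mul_le_mul_of_nonneg_right (le_max_left A 0) (norm_nonneg _)))).trans ?_
          rw [henorm]
          exact Finset.single_le_sum
            (f := fun i => ENNReal.ofReal (max A 0 ^ q) * ‖F i z‖ₑ ^ q)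
            (fun _ _ => zero_le) (Finset.mem_univ i)
      _ = ∑ i, ENNReal.ofReal (max A 0 ^ q) * ∫⁻ z, ‖F i z‖ₑ ^ q ∂μ := by
          have hmeas : ∀ i, Measurable fun z => ‖F i z‖ₑ ^ q := fun i =>
            (hF i).1.continuous.measurable.enorm.pow_const q
          rw [lintegral_finsetSum _ fun i _ => (hmeas i).const_mul _]
          exact Finset.sum_congr rfl fun i _ => lintegral_const_mul _ (hmeas i)
      _ < ∞ := by
          refine ENNReal.sum_lt_top.2 fun i _ => ENNReal.mul_lt_top ENNReal.ofReal_lt_top ?_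
          have := lintegral_rpow_enorm_lt_top_of_eLpNorm_lt_top hq0 ENNReal.ofReal_ne_top
            (hμ (F i) (hF i)).eLpNorm_lt_top
          rwa [hqr] at this
  · rintro hint f ⟨hf, B, hB⟩
    have hA : 0 < max B 1 := lt_max_of_lt_right one_pos
    have hfB : ∀ z, ‖f z‖ ≤ max B 1 * ω ‖z‖₊ := fun z =>
      (div_le_iff₀ (hω.pos _)).1 ((hB ⟨z, rfl⟩).trans (le_max_left B 1))
    refine ⟨hf.continuous.aestronglyMeasurable,
      (eLpNorm_lt_top_iff_lintegral_rpow_enorm_lt_top hq0 ENNReal.ofReal_ne_top).2 ?_⟩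
    rw [hqr]
    calc ∫⁻ z, ‖f z‖ₑ ^ q ∂μ
        ≤ ∫⁻ z, ENNReal.ofReal (max B 1 ^ q) *
            ENNReal.ofReal (GrowthSpaces.associatedWeightFunction ω ‖z‖₊ ^ q) ∂μ := by
          refine lintegral_mono fun z => ?_
          rw [← henorm]
          exact hofReal (norm_nonneg _) hA.le (GrowthSpaces.associatedWeightFunction_nonneg _ _)
            (GrowthSpaces.norm_le_mul_associatedWeightFunction hω hf hA hfB z)
      _ < ∞ := by
          rw [lintegral_const_mul' _ _ ENNReal.ofReal_ne_top]
          exact ENNReal.mul_lt_top ENNReal.ofReal_lt_top hint
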